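/- Let $n\ge 0$ and let $M$ be a connected (Hausdorff, second countable) smooth manifold without boundary, of dimension $2n+1$, with a contact structure $\xi$; that is, $\xi=\ker\alpha$ is a field of hyperplanes for some smooth nowhere vanishing $1$-form $\alpha$ on $M$ such that $d\alpha|_{\xi}$ is non-degenerate at every point (equivalently, $\alpha\wedge(d\alpha)^n$ is a volume form). A contactomorphism of $(M,\xi)$ is a diffeomorphism $\phi$ of $M$ with $\phi_*\xi=\xi$. Let $\mathrm{Cont}_0^{\,c}(M,\xi)$ be the identity component of the group of compactly supported contactomorphisms, i.e. the group, under composition, of those diffeomorphisms $\phi$ for which there is a smooth isotopy $\{\phi_t\}_{t\in[0,1]}$ of contactomorphisms of $(M,\xi)$, all equal to the identity outside one compact subset of $M$, with $\phi_0=\mathrm{id}$ and $\phi_1=\phi$. A conjugation-invariant norm on a group $G$ is a function $\|\cdot\|:G\to[0,\infty)$ such that, for all $g,h\in G$, $\|g\|=0$ if and only if $g=1$, $\|g^{-1}\|=\|g\|$, $\|gh\|\le\|g\|+\|h\|$ and $\|hgh^{-1}\|=\|g\|$. It is called fine if it takes positive values arbitrarily close to zero: for every $\varepsilon>0$ there is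 $g\in G$ with $0<\|g\|<\varepsilon$. Proposition. The group $\mathrm{Cont}_0^{\,c}(M,\xi)$ does not admit any conjugation-invariant norm which is fine. -/

import Mathlib

open Set Manifold
open scoped ContDiff

noncomputable section

/-- A field of covectors on a manifold `M` of dimension `d`, i.e. a (not necessarily smooth)
differential 1-form. -/
abbrev CovectorField (d : ℕ) (M : Type*) [TopologicalSpace M]
    [ChartedSpace (EuclideanSpace ℝ (Fin d)) M] : Type _ :=
  Π x : M, TangentSpace (𝓡 d) x →L[ℝ] ℝ

/-- A field of linear subspaces of the tangent spaces of `M`. -/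
abbrev TangentDistribution (d : ℕ) (M : Type*) [TopologicalSpace M]
    [ChartedSpace (EuclideanSpace ℝ (Fin d)) M] : Type _ :=
  Π x : M, Submodule ℝ (TangentSpace (𝓡 d) x)

/-- A 1-form is smooth if it is a smooth section of the cotangent bundle. -/
def CovectorField.IsSmooth {d : ℕ} {M : Type*} [TopologicalSpace M]
    [ChartedSpace (EuclideanSpace ℝ (Fin d)) M] [IsManifold (𝓡 d) ∞ M]
    (α : CovectorField d M) : Prop :=
  ContMDiff (𝓡 d) ((𝓡 d).prod 𝓘(ℝ, EuclideanSpace ℝ (Fin d) →L[ℝ] ℝ)) ∞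
    (fun x : M => Bundle.TotalSpace.mk' (EuclideanSpace ℝ (Fin d) →L[ℝ] ℝ)
      (E := fun x : M => TangentSpace (𝓡 d) x →L[ℝ] Bundle.Trivial M ℝ x) x (α x))

/-- The coordinate expression of a 1-form in the preferred chart `c` around `x₀`: the pullback of
`α` by `c⁻¹`, as a 1-form on the model space. -/
def CovectorField.inChart {d : ℕ} {M : Type*} [TopologicalSpace M]
    [ChartedSpace (EuclideanSpace ℝ (Fin d)) M] (α : CovectorField d M) (x₀ : M)
    (u : EuclideanSpace ℝ (Fin d)) : EuclideanSpace ℝ (Fin d) [⋀^Fin 1]→L[ℝ] ℝ :=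
  ContinuousAlternatingMap.ofSubsingleton ℝ (EuclideanSpace ℝ (Fin d)) ℝ (0 : Fin 1)
    ((α ((extChartAt (𝓡 d) x₀).symm u)).comp
      (mfderiv 𝓘(ℝ, EuclideanSpace ℝ (Fin d)) (𝓡 d) (extChartAt (𝓡 d) x₀).symm u))

/-- The exterior derivative `dα` of a 1-form at the point `x`, evaluated on two tangent vectors,
computed in the preferred chart around `x`. -/
def CovectorField.d {d : ℕ} {M : Type*} [TopologicalSpace M]
    [ChartedSpace (EuclideanSpace ℝ (Fin d)) M] (α : CovectorField d M) (x : M)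
    (v w : TangentSpace (𝓡 d) x) : ℝ :=
  extDeriv (α.inChart x) (extChartAt (𝓡 d) x x)
    ![mfderiv (𝓡 d) 𝓘(ℝ, EuclideanSpace ℝ (Fin d)) (extChartAt (𝓡 d) x) x v,
      mfderiv (𝓡 d) 𝓘(ℝ, EuclideanSpace ℝ (Fin d)) (extChartAt (𝓡 d) x) x w]

/-- A contact form on a manifold of dimension `2n+1`: a smooth nowhere vanishing 1-form `α` such
that `dα` is non-degenerate on the hyperplanes `ker α` (equivalently, `α ∧ (dα)ⁿ` is a volume
form). -/
structure IsContactForm {n : ℕ} {M : Type*} [TopologicalSpace M]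
    [ChartedSpace (EuclideanSpace ℝ (Fin (2 * n + 1))) M] [IsManifold (𝓡 (2 * n + 1)) ∞ M]
    (α : CovectorField (2 * n + 1) M) : Prop where
  smooth : α.IsSmooth
  ne_zero : ∀ x, α x ≠ 0
  nondegenerate : ∀ x, ∀ v : TangentSpace (𝓡 (2 * n + 1)) x, α x v = 0 →
    (∀ w : TangentSpace (𝓡 (2 * n + 1)) x, α x w = 0 → α.d x v w = 0) → v = 0

/-- A (co-oriented) contact structure on a manifold of dimension `2n+1`: a field of hyperplanes
that is the kernel of a contact form. -/
def IsContactStructure {n : ℕ} {M : Type*} [TopologicalSpace M]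
    [ChartedSpace (EuclideanSpace ℝ (Fin (2 * n + 1))) M] [IsManifold (𝓡 (2 * n + 1)) ∞ M]
    (ξ : TangentDistribution (2 * n + 1) M) : Prop :=
  ∃ α : CovectorField (2 * n + 1) M, IsContactForm α ∧
    ∀ (x : M) (v : TangentSpace (𝓡 (2 * n + 1)) x), v ∈ ξ x ↔ α x v = 0

/-- `φ` is a diffeomorphism of `M` that preserves the distribution: `φ_* ξ = ξ`. If `ξ` is a
contact structure these are the contactomorphisms of `(M, ξ)`. -/
structure IsContactomorphism {d : ℕ} {M : Type*} [TopologicalSpace M]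
    [ChartedSpace (EuclideanSpace ℝ (Fin d)) M]
    (ξ : TangentDistribution d M) (φ : Equiv.Perm M) : Prop where
  contMDiff : ContMDiff (𝓡 d) (𝓡 d) ∞ φ
  contMDiff_symm : ContMDiff (𝓡 d) (𝓡 d) ∞ φ.symm
  map_eq : ∀ x, (ξ x).map (mfderiv (𝓡 d) (𝓡 d) φ x).toLinearMap = ξ (φ x)

/-- A compactly supported contact isotopy `{φ_t}`, `t ∈ [0,1]`, starting at the identity: a smooth
isotopy (the level-preserving map `(t,x) ↦ (t, φ_t x)` is a diffeomorphism of `[0,1] × M`) through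
contactomorphisms that are all supported in one compact set. The values of `γ` at `t ∉ [0,1]` play
no role. -/
structure IsCompactContactIsotopy {d : ℕ} {M : Type*} [TopologicalSpace M]
    [ChartedSpace (EuclideanSpace ℝ (Fin d)) M]
    (ξ : TangentDistribution d M) (γ : ℝ → Equiv.Perm M) : Prop where
  smooth : ContMDiffOn (𝓘(ℝ, ℝ).prod (𝓡 d)) (𝓡 d) ∞ (fun p : ℝ × M => γ p.1 p.2)
    (Icc (0 : ℝ) 1 ×ˢ univ)
  smooth_symm : ContMDiffOn (𝓘(ℝ, ℝ).prod (𝓡 d)) (𝓡 d) ∞ (fun p : ℝ × M => (γ p.1).symm p.2)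
    (Icc (0 : ℝ) 1 ×ˢ univ)
  contacto : ∀ t ∈ Icc (0 : ℝ) 1, IsContactomorphism ξ (γ t)
  compact : ∃ K : Set M, IsCompact K ∧ ∀ t ∈ Icc (0 : ℝ) 1, ∀ x, x ∉ K → γ t x = x
  zero : γ 0 = 1

theorem IsContactomorphism.one {d : ℕ} {M : Type*} [TopologicalSpace M]
    [ChartedSpace (EuclideanSpace ℝ (Fin d)) M]
    (ξ : TangentDistribution d M) : IsContactomorphism ξ 1 where
  contMDiff := contMDiff_id
  contMDiff_symm := contMDiff_id
  map_eq x := by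
    have : mfderiv (𝓡 d) (𝓡 d) (⇑(1 : Equiv.Perm M)) x = ContinuousLinearMap.id ℝ _ :=
      mfderiv_id
    rw [this]
    exact Submodule.map_id _

theorem IsContactomorphism.mul {d : ℕ} {M : Type*} [TopologicalSpace M]
    [ChartedSpace (EuclideanSpace ℝ (Fin d)) M]
    {ξ : TangentDistribution d M} {φ ψ : Equiv.Perm M}
    (hφ : IsContactomorphism ξ φ) (hψ : IsContactomorphism ξ ψ) :
    IsContactomorphism ξ (φ * ψ) where
  contMDiff := hφ.contMDiff.comp hψ.contMDiff
  contMDiff_symm := hψ.contMDiff_symm.comp hφ.contMDiff_symm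
  map_eq x := by
    have h : mfderiv (𝓡 d) (𝓡 d) (⇑(φ * ψ)) x =
        (mfderiv (𝓡 d) (𝓡 d) φ (ψ x)).comp (mfderiv (𝓡 d) (𝓡 d) ψ x) :=
      mfderiv_comp x (hφ.contMDiff.mdifferentiableAt (by simp))
        (hψ.contMDiff.mdifferentiableAt (by simp))
    rw [h]
    refine (Submodule.map_comp _ _ _).trans ?_
    rw [hψ.map_eq x]
    exact hφ.map_eq (ψ x)

theorem IsContactomorphism.inv {d : ℕ} {M : Type*} [TopologicalSpace M]
    [ChartedSpace (EuclideanSpace ℝ (Fin d)) M]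
    {ξ : TangentDistribution d M} {φ : Equiv.Perm M}
    (hφ : IsContactomorphism ξ φ) : IsContactomorphism ξ φ⁻¹ where
  contMDiff := hφ.contMDiff_symm
  contMDiff_symm := hφ.contMDiff
  map_eq x := by
    obtain ⟨y, rfl⟩ := φ.surjective x
    have h : (mfderiv (𝓡 d) (𝓡 d) (⇑φ⁻¹) (φ y)).comp (mfderiv (𝓡 d) (𝓡 d) φ y) =
        ContinuousLinearMap.id ℝ (TangentSpace (𝓡 d) y) := by
      have h1 : mfderiv (𝓡 d) (𝓡 d) (⇑φ⁻¹ ∘ ⇑φ) y =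
          (mfderiv (𝓡 d) (𝓡 d) (⇑φ⁻¹) (φ y)).comp (mfderiv (𝓡 d) (𝓡 d) φ y) :=
        mfderiv_comp y (hφ.contMDiff_symm.mdifferentiableAt (by simp))
          (hφ.contMDiff.mdifferentiableAt (by simp))
      have h2 : (⇑φ⁻¹ ∘ ⇑φ) = id := by ext z; simp
      rw [h2] at h1
      exact h1.symm.trans mfderiv_id
    rw [← hφ.map_eq y]
    have h3 : (φ⁻¹ : Equiv.Perm M) (φ y) = y := by simp
    refine (Submodule.map_comp _ _ _).symm.trans ?_
    have h4 : Submodule.map (ContinuousLinearMap.id ℝ (TangentSpace (𝓡 d) y)).toLinearMap (ξ y)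
        = ξ y := Submodule.map_id _
    rw [h3]
    refine Eq.trans ?_ h4
    rw [← h]
    rfl

/-- The identity component `Cont₀ᶜ(M, ξ)` of the group of compactly supported contactomorphisms:
the contactomorphisms that are the time-1 map of a compactly supported contact isotopy starting at
the identity, with composition as group law. -/
def identityComponentCont {d : ℕ} {M : Type*} [TopologicalSpace M]
    [ChartedSpace (EuclideanSpace ℝ (Fin d)) M]
    (ξ : TangentDistribution d M) : Subgroup (Equiv.Perm M) where
  carrier := {φ | ∃ γ : ℝ → Equiv.Perm M, IsCompactContactIsotopy ξ γ ∧ γ 1 = φ}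
  one_mem' := ⟨fun _ => 1, ⟨contMDiffOn_snd, contMDiffOn_snd,
    fun _ _ => IsContactomorphism.one ξ, ⟨∅, isCompact_empty, fun _ _ _ _ => rfl⟩, rfl⟩, rfl⟩
  mul_mem' := by
    rintro _ _ ⟨γ, hγ, rfl⟩ ⟨δ, hδ, rfl⟩
    refine ⟨fun t => γ t * δ t, ⟨?_, ?_, ?_, ?_, ?_⟩, rfl⟩
    · exact hγ.smooth.comp (contMDiffOn_fst.prodMk hδ.smooth) (fun p hp => ⟨hp.1, mem_univ _⟩)
    · exact hδ.smooth_symm.comp (contMDiffOn_fst.prodMk hγ.smooth_symm)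
        (fun p hp => ⟨hp.1, mem_univ _⟩)
    · exact fun t ht => (hγ.contacto t ht).mul (hδ.contacto t ht)
    · obtain ⟨K, hK, h⟩ := hγ.compact
      obtain ⟨L, hL, h'⟩ := hδ.compact
      refine ⟨K ∪ L, hK.union hL, fun t ht x hx => ?_⟩
      rw [mem_union, not_or] at hx
      rw [Equiv.Perm.mul_apply, h' t ht x hx.2, h t ht x hx.1]
    · simp only [hγ.zero, hδ.zero, mul_one]
  inv_mem' := by
    rintro _ ⟨γ, hγ, rfl⟩
    refine ⟨fun t => (γ t)⁻¹, ⟨hγ.smooth_symm, hγ.smooth, ?_, ?_, ?_⟩, rfl⟩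
    · exact fun t ht => (hγ.contacto t ht).inv
    · obtain ⟨K, hK, h⟩ := hγ.compact
      refine ⟨K, hK, fun t ht x hx => ?_⟩
      rw [Equiv.Perm.inv_eq_iff_eq, h t ht x hx]
    · simp only [hγ.zero, inv_one]

/-- A norm on a group is conjugation-invariant if `‖h g h⁻¹‖ = ‖g‖` for all `g`, `h`. -/
def GroupNorm.IsConjInvariant {G : Type*} [Group G] (ν : GroupNorm G) : Prop :=
  ∀ g h : G, ν (h * g * h⁻¹) = ν g

/-- A norm on a group is fine if it takes (positive) values arbitrarily close to zero. -/
def GroupNorm.IsFine {G : Type*} [Group G] (ν : GroupNorm G) : Prop :=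
  ∀ ε : ℝ, 0 < ε → ∃ g : G, 0 < ν g ∧ ν g < ε

end

noncomputable section

/-- If `ψ` displaces the set `B`, then the norm of a commutator of two elements supported in `B` is
at most four times the norm of `ψ`. -/
theorem GroupNorm.IsConjInvariant.commutator_le {X : Type*} {G : Subgroup (Equiv.Perm X)}
    {ν : GroupNorm G} (hν : ν.IsConjInvariant) {B : Set X} {f h ψ : G}
    (hf : ∀ x ∉ B, (f : Equiv.Perm X) x = x) (hh : ∀ x ∉ B, (h : Equiv.Perm X) x = x)
    (hψ : ∀ x ∈ B, (ψ : Equiv.Perm X) x ∉ B) :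
    ν (f * h * f⁻¹ * h⁻¹) ≤ 4 * ν ψ := by
  have hd : Equiv.Perm.Disjoint ((ψ * f * ψ⁻¹ : G) : Equiv.Perm X) (h : Equiv.Perm X) := by
    intro x
    by_cases hx : x ∈ B
    · left
      have h1 : ((ψ : Equiv.Perm X)⁻¹ x) ∉ B := fun h1 => by
        have := hψ _ h1
        rw [Equiv.Perm.coe_inv, Equiv.apply_symm_apply] at this
        exact this hx
      simp only [Subgroup.coe_mul, InvMemClass.coe_inv, Equiv.Perm.mul_apply]
      rw [hf _ h1, Equiv.Perm.coe_inv, Equiv.apply_symm_apply]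
    · exact Or.inr (hh x hx)
  have hc : (ψ * f * ψ⁻¹) * h = h * (ψ * f * ψ⁻¹) := Subtype.ext hd.commute.eq
  set k : G := ψ * f * ψ⁻¹ with hk
  have e1 : f * h * f⁻¹ * h⁻¹ = (f * k⁻¹) * (h * (f * k⁻¹)⁻¹ * h⁻¹) := by
    have : k⁻¹ * h * k = h := by rw [mul_assoc, ← hc, inv_mul_cancel_left]
    calc f * h * f⁻¹ * h⁻¹ = f * (k⁻¹ * h * k) * f⁻¹ * h⁻¹ := by rw [this]
      _ = _ := by group
  have e2 : f * k⁻¹ = (f * ψ * f⁻¹) * ψ⁻¹ := by rw [hk]; group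
  have h2 : ν (f * k⁻¹) ≤ 2 * ν ψ := by
    rw [e2]
    have h3 : ν (f * ψ * f⁻¹ * ψ⁻¹) ≤ ν (f * ψ * f⁻¹) + ν ψ⁻¹ := map_mul_le_add ν _ _
    rw [hν, map_inv_eq_map ν] at h3
    linarith
  rw [e1]
  have h4 : ν ((f * k⁻¹) * (h * (f * k⁻¹)⁻¹ * h⁻¹)) ≤ ν (f * k⁻¹) + ν (h * (f * k⁻¹)⁻¹ * h⁻¹) :=
    map_mul_le_add ν _ _
  rw [hν, map_inv_eq_map ν] at h4
  linarith

/-- A non-trivial homeomorphism of a Hausdorff space displaces a non-empty open subset of any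
open set that contains a point moved by it. -/
theorem exists_isOpen_displaced {X : Type*} [TopologicalSpace X] [T2Space X] {f : X → X}
    (hf : Continuous f) {x : X} (hx : f x ≠ x) {U : Set X} (hU : IsOpen U) (hxU : x ∈ U) :
    ∃ V ⊆ U, IsOpen V ∧ x ∈ V ∧ ∀ y ∈ V, f y ∉ V := by
  obtain ⟨A, B, hA, hB, hxA, hxB, hAB⟩ := t2_separation hx
  refine ⟨U ∩ B ∩ f ⁻¹' A, fun y hy => hy.1.1, (hU.inter hB).inter (hA.preimage hf),
    ⟨⟨hxU, hxB⟩, hxA⟩, fun y hy hy' => ?_⟩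
  exact Set.disjoint_left.1 hAB hy.2 hy'.1.2

/-- A group of homeomorphisms of a Hausdorff space has no fine conjugation-invariant norm if there
is a non-empty open set that can be moved into any other one, and every non-empty open set supports
a non-trivial element. -/
theorem not_exists_isFine {X : Type*} [TopologicalSpace X] [T2Space X]
    {G : Subgroup (Equiv.Perm X)} (hG : ∀ g ∈ G, Continuous g) {B : Set X} (hB : IsOpen B)
    (hBne : B.Nonempty)
    (hsq : ∀ V : Set X, IsOpen V → V.Nonempty → ∃ g ∈ G, ∀ x ∈ B, g x ∈ V)
    (hsupp : ∀ V : Set X, IsOpen V → V.Nonempty → ∃ g ∈ G, g ≠ 1 ∧ ∀ x ∉ V, g x = x) :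
    ¬ ∃ ν : GroupNorm G, ν.IsConjInvariant ∧ ν.IsFine := by
  rintro ⟨ν, hν, hfine⟩
  obtain ⟨f, hfG, hf1, hf⟩ := hsupp B hB hBne
  obtain ⟨y, hy⟩ : ∃ y, f y ≠ y := by
    by_contra! hcon
    exact hf1 (Equiv.ext hcon)
  have hyB : y ∈ B := by
    by_contra hyB
    exact hy (hf y hyB)
  obtain ⟨V, hVB, hV, hyV, hVd⟩ := exists_isOpen_displaced (hG f hfG) hy hB hyB
  obtain ⟨h, hhG, hh1, hh⟩ := hsupp V hV ⟨y, hyV⟩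
  obtain ⟨z, hz⟩ : ∃ z, h z ≠ z := by
    by_contra! hcon
    exact hh1 (Equiv.ext hcon)
  have hzV : h z ∈ V := by
    by_contra hzV
    exact hz (h.injective (hh _ hzV))
  set F : G := ⟨f, hfG⟩
  set H : G := ⟨h, hhG⟩
  have hne : F * H * F⁻¹ * H⁻¹ ≠ 1 := by
    intro hcon
    have h1 : f * h * f⁻¹ * h⁻¹ = 1 := congrArg Subtype.val hcon
    have h2 : (f * h * f⁻¹ * h⁻¹) (h z) = h z := by rw [h1]; rfl
    simp only [Equiv.Perm.mul_apply, Equiv.Perm.coe_inv, Equiv.symm_apply_apply] at h2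
    have hz' : z ∈ V := by
      by_contra hz'
      exact hz (hh z hz')
    have h3 : f.symm z ∉ V := fun h3 => by
      have := hVd _ h3
      rw [Equiv.apply_symm_apply] at this
      exact this hz'
    rw [hh _ h3, Equiv.apply_symm_apply] at h2
    exact hz h2.symm
  have hpos : 0 < ν (F * H * F⁻¹ * H⁻¹) := by
    refine lt_of_le_of_ne (apply_nonneg ν _) (fun h0 => hne ?_)
    exact ν.eq_one_of_map_eq_zero' _ h0.symm
  obtain ⟨ψ, hψ0, hψ⟩ := hfine (ν (F * H * F⁻¹ * H⁻¹) / 4) (by positivity)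
  have hψ1 : (ψ : Equiv.Perm X) ≠ 1 := fun hcon => by
    have : ψ = 1 := Subtype.ext hcon
    rw [this, map_one_eq_zero ν] at hψ0
    exact lt_irrefl _ hψ0
  obtain ⟨x, hx⟩ : ∃ x, (ψ : Equiv.Perm X) x ≠ x := by
    by_contra! hcon
    exact hψ1 (Equiv.ext hcon)
  obtain ⟨W, -, hW, hxW, hWd⟩ := exists_isOpen_displaced (hG ψ ψ.2) hx isOpen_univ (mem_univ x)
  obtain ⟨g, hgG, hg⟩ := hsq W hW ⟨x, hxW⟩
  have key := hν.commutator_le (B := B) (f := F) (h := H)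
    (ψ := (⟨g, hgG⟩ : G)⁻¹ * ψ * ((⟨g, hgG⟩ : G)⁻¹)⁻¹) hf
    (fun x hx => hh x (fun hxV => hx (hVB hxV))) (fun x hx hcon => by
      have h1 := hg _ hcon
      simp only [inv_inv, Subgroup.coe_mul, InvMemClass.coe_inv, Equiv.Perm.mul_apply,
        Equiv.Perm.coe_inv, Equiv.apply_symm_apply] at h1
      exact hWd _ (hg x hx) h1)
  rw [hν] at key
  linarith

/-- In a connected space, sets that can be squeezed locally can be squeezed into any open set. -/
theorem exists_forall_squeezed {X : Type*} [TopologicalSpace X] [ConnectedSpace X]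
    {G : Subgroup (Equiv.Perm X)}
    (hloc : ∀ x : X, ∃ N : Set X, IsOpen N ∧ x ∈ N ∧ ∀ V : Set X, IsOpen V → (V ∩ N).Nonempty →
      ∃ g ∈ G, ∀ y ∈ N, g y ∈ V) :
    ∃ B : Set X, IsOpen B ∧ B.Nonempty ∧
      ∀ V : Set X, IsOpen V → V.Nonempty → ∃ g ∈ G, ∀ x ∈ B, g x ∈ V := by
  obtain ⟨x₀⟩ : Nonempty X := inferInstance
  obtain ⟨B, hB, hx₀, hBsq⟩ := hloc x₀
  refine ⟨B, hB, ⟨x₀, hx₀⟩, ?_⟩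
  set A : Set X := {y | ∀ V : Set X, IsOpen V → y ∈ V → ∃ g ∈ G, ∀ x ∈ B, g x ∈ V} with hA
  have hx₀A : x₀ ∈ A := fun V hV hxV => hBsq V hV ⟨x₀, hxV, hx₀⟩
  have hclosed : IsClosed A := by
    refine isClosed_of_closure_subset fun y hy V hV hyV => ?_
    obtain ⟨z, hzV, hzA⟩ := mem_closure_iff.1 hy V hV hyV
    exact hzA V hV hzV
  have hopen : IsOpen A := by
    refine isOpen_iff_forall_mem_open.2 fun y hy => ?_
    obtain ⟨N, hN, hyN, hNsq⟩ := hloc y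
    refine ⟨N, fun z hz V hV hzV => ?_, hN, hyN⟩
    obtain ⟨g, hgG, hg⟩ := hy N hN hyN
    obtain ⟨g', hg'G, hg'⟩ := hNsq V hV ⟨z, hzV, hz⟩
    exact ⟨g' * g, mul_mem hg'G hgG, fun x hx => hg' _ (hg x hx)⟩
  have huniv : A = univ := IsClopen.eq_univ ⟨hclosed, hopen⟩ ⟨x₀, hx₀A⟩
  rintro V hV ⟨y, hyV⟩
  have hy : y ∈ A := huniv ▸ mem_univ y
  exact hy V hV hyV

section Superposition

open scoped Topology unitInterval

universe u
variable {E F : Type u} [NormedAddCommGroup E] [NormedSpace ℝ E] [NormedAddCommGroup F]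
  [NormedSpace ℝ F]

/-- Pointwise application of a continuous family of linear maps to a curve, as a bounded bilinear
map. -/
def curveApplyL (E F : Type u) [NormedAddCommGroup E] [NormedSpace ℝ E] [NormedAddCommGroup F]
    [NormedSpace ℝ F] : C(I, E →L[ℝ] F) →L[ℝ] C(I, E) →L[ℝ] C(I, F) :=
  LinearMap.mkContinuous₂
    (LinearMap.mk₂ ℝ (fun (A : C(I, E →L[ℝ] F)) (g : C(I, E)) => (⟨fun t => A t (g t), by fun_prop⟩ : C(I, F)))
      (fun A B g => by ext t; simp) (fun c A g => by ext t; simp)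
      (fun A g h => by ext t; simp) (fun c A g => by ext t; simp)) 1 (by
    intro A g
    rw [one_mul]
    refine (ContinuousMap.norm_le _ (by positivity)).2 fun t => ?_
    exact ((A t).le_opNorm (g t)).trans
      (mul_le_mul (A.norm_coe_le_norm t) (g.norm_coe_le_norm t) (norm_nonneg (g t))
        (norm_nonneg A)))

theorem hasFDerivAt_superposition {f : C(E, F)} {f' : C(E, E →L[ℝ] F)}
    (hf : ∀ x, HasFDerivAt f (f' x) x) (g : C(I, E)) :
    HasFDerivAt (fun g : C(I, E) => f.comp g) (curveApplyL E F (f'.comp g)) g := by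
  rw [hasFDerivAt_iff_isLittleO_nhds_zero, Asymptotics.isLittleO_iff]
  intro ε hε
  have hc : ContinuousAt (fun g : C(I, E) => f'.comp g) g :=
    (ContinuousMap.continuous_postcomp f').continuousAt
  obtain ⟨δ, hδ, H⟩ := (Metric.continuousAt_iff (α := C(I, E)) (β := C(I, E →L[ℝ] F))).1 hc ε hε
  filter_upwards [Metric.ball_mem_nhds (0 : C(I, E)) hδ] with h hh
  rw [mem_ball_zero_iff] at hh
  refine (ContinuousMap.norm_le _ (by positivity)).2 fun t => ?_
  have hbd : ∀ y ∈ Metric.ball (g t) δ, ‖f' y - f' (g t)‖ ≤ ε := by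
    intro y hy
    have h1 : dist (g + ContinuousMap.const I (y - g t)) g < δ := by
      rw [dist_eq_norm, add_sub_cancel_left]
      refine lt_of_le_of_lt ((ContinuousMap.norm_le _ (norm_nonneg (y - g t))).2 fun s => le_rfl) ?_
      rwa [← dist_eq_norm]
    have h2 := H h1
    have h3 := (ContinuousMap.dist_apply_le_dist
      (f := f'.comp (g + ContinuousMap.const I (y - g t))) (g := f'.comp g) t).trans h2.le
    simpa [dist_eq_norm] using h3
  have hmem : g t + h t ∈ Metric.ball (g t) δ := by
    rw [mem_ball_iff_norm, add_sub_cancel_left]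
    exact (h.norm_coe_le_norm t).trans_lt hh
  have key := (convex_ball (g t) δ).norm_image_sub_le_of_norm_hasFDerivWithin_le'
    (fun y _ => (hf y).hasFDerivWithinAt) hbd (Metric.mem_ball_self hδ) hmem
  rw [add_sub_cancel_left] at key
  exact key.trans (mul_le_mul_of_nonneg_left (h.norm_coe_le_norm t) hε.le)

theorem contDiff_superposition_nat (n : ℕ) : ∀ {F : Type u} [NormedAddCommGroup F]
    [NormedSpace ℝ F] (f : C(E, F)), ContDiff ℝ n f →
    ContDiff ℝ n (fun g : C(I, E) => f.comp g) := by
  induction n with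
  | zero =>
    intro F _ _ f _
    exact contDiff_zero.2 (ContinuousMap.continuous_postcomp f)
  | succ n ih =>
    intro F _ _ f hf
    have hf' : ContDiff ℝ n (fderiv ℝ f) := hf.fderiv_right (by norm_cast)
    refine contDiff_succ_iff_hasFDerivAt.2
      ⟨fun g => curveApplyL E F ((⟨fderiv ℝ f, hf'.continuous⟩ : C(E, E →L[ℝ] F)).comp g), ?_, ?_⟩
    · exact (ContinuousLinearMap.contDiff (E := C(I, E →L[ℝ] F)) (F := C(I, E) →L[ℝ] C(I, F))
        (curveApplyL E F)).comp (ih ⟨fderiv ℝ f, hf'.continuous⟩ hf')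
    · intro g
      exact hasFDerivAt_superposition (f' := ⟨fderiv ℝ f, hf'.continuous⟩)
        (fun x => (hf.differentiable (by simp) x).hasFDerivAt) g

/-- Composition with a smooth map is a smooth operation on curves. -/
theorem contDiff_superposition (f : C(E, F)) (hf : ContDiff ℝ ∞ f) :
    ContDiff ℝ ∞ (fun g : C(I, E) => f.comp g) :=
  contDiff_infty.2 fun n => contDiff_superposition_nat n f (hf.of_le (by exact_mod_cast le_top))

/-- Integration of curves, `g ↦ (t ↦ ∫₀ᵗ g)`. -/
def curveIntegralL (E : Type u) [NormedAddCommGroup E] [NormedSpace ℝ E] [CompleteSpace E] :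
    C(I, E) →L[ℝ] C(I, E) :=
  LinearMap.mkContinuous
    { toFun := fun g => ⟨fun t => ∫ τ in (0 : ℝ)..t, g (projIcc 0 1 zero_le_one τ),
        (intervalIntegral.continuous_primitive (fun a b =>
          Continuous.intervalIntegrable (by fun_prop) _ _) 0).comp continuous_subtype_val⟩
      map_add' := fun g h => by
        ext t
        simp only [ContinuousMap.coe_mk, ContinuousMap.add_apply]
        exact intervalIntegral.integral_add (Continuous.intervalIntegrable (by fun_prop) _ _)
          (Continuous.intervalIntegrable (by fun_prop) _ _)
      map_smul' := fun c g => by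
        ext t
        simp only [ContinuousMap.coe_mk, ContinuousMap.smul_apply, RingHom.id_apply]
        exact intervalIntegral.integral_smul _ _ } 1 (by
    intro g
    rw [one_mul]
    refine (ContinuousMap.norm_le _ (norm_nonneg g)).2 fun t => ?_
    refine (intervalIntegral.norm_integral_le_of_norm_le_const (C := ‖g‖)
      (fun τ _ => g.norm_coe_le_norm _)).trans ?_
    rw [sub_zero, abs_of_nonneg t.2.1]
    exact mul_le_of_le_one_right (norm_nonneg _) t.2.2)

theorem curveIntegralL_apply [CompleteSpace E] (g : C(I, E)) (t : I) :
    curveIntegralL E g t = ∫ τ in (0 : ℝ)..t, g (projIcc 0 1 zero_le_one τ) := rfl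

theorem norm_curveIntegralL_le [CompleteSpace E] : ‖curveIntegralL E‖ ≤ 1 :=
  LinearMap.mkContinuous_norm_le _ zero_le_one _

/-- The curves with constant value. -/
def curveConstL (E : Type u) [NormedAddCommGroup E] [NormedSpace ℝ E] : E →L[ℝ] C(I, E) :=
  LinearMap.mkContinuous
    { toFun := fun x => ContinuousMap.const I x
      map_add' := fun _ _ => rfl
      map_smul' := fun _ _ => rfl } 1 (by
    intro x
    rw [one_mul]
    exact (ContinuousMap.norm_le _ (norm_nonneg x)).2 fun t => le_rfl)

theorem curveConstL_apply (x : E) (t : I) : curveConstL E x t = x := rfl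

/-- The equation `γ = x + s ∫ f(γ)` solved by the rescaled integral curves of `f`. -/
def curveDefect [CompleteSpace E] (f : C(E, E)) (q : (E × ℝ) × C(I, E)) : C(I, E) :=
  q.2 - curveConstL E q.1.1 - q.1.2 • curveIntegralL E (f.comp q.2)

theorem contDiff_curveDefect [CompleteSpace E] (f : C(E, E)) (hf : ContDiff ℝ ∞ f) :
    ContDiff ℝ ∞ (curveDefect f) := by
  have h1 := (contDiff_superposition f hf).comp (contDiff_snd (E := E × ℝ) (F := C(I, E)))
  have h2 := (curveIntegralL E).contDiff.comp h1
  have h3 : ContDiff ℝ ∞ (fun q : (E × ℝ) × C(I, E) => curveConstL E q.1.1) :=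
    (curveConstL E).contDiff.comp (contDiff_fst.comp contDiff_fst)
  exact (contDiff_snd.sub h3).sub ((contDiff_snd.comp contDiff_fst).smul h2)

theorem eq_of_curveDefect_eq [CompleteSpace E] {f : C(E, E)} {K : NNReal} (hK : LipschitzWith K f)
    {x : E} {s : ℝ} (hs : |s| * K < 1) {γ δ : C(I, E)}
    (h : curveDefect f ((x, s), γ) = curveDefect f ((x, s), δ)) : γ = δ := by
  have h1 : γ - δ = s • curveIntegralL E (f.comp γ - f.comp δ) := by
    simp only [curveDefect] at h
    rw [map_sub, smul_sub]
    have h' := congrArg (· + (curveConstL E x + s • curveIntegralL E (f.comp γ)) - δ) h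
    convert h' using 1 <;> abel
  have h2 : ‖f.comp γ - f.comp δ‖ ≤ K * ‖γ - δ‖ := by
    refine (ContinuousMap.norm_le _ (by positivity)).2 fun t => ?_
    refine (hK.norm_sub_le _ _).trans ?_
    exact mul_le_mul_of_nonneg_left ((γ - δ).norm_coe_le_norm t) K.2
  have h3 : ‖γ - δ‖ ≤ |s| * K * ‖γ - δ‖ := by
    calc ‖γ - δ‖ = |s| * ‖curveIntegralL E (f.comp γ - f.comp δ)‖ := by
          rw [h1, norm_smul, Real.norm_eq_abs]
      _ ≤ |s| * (K * ‖γ - δ‖) := by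
          refine mul_le_mul_of_nonneg_left ?_ (abs_nonneg s)
          refine ((curveIntegralL E).le_of_opNorm_le norm_curveIntegralL_le _).trans ?_
          rwa [one_mul]
      _ = _ := by ring
  have h4 : ‖γ - δ‖ = 0 := by nlinarith [norm_nonneg (γ - δ)]
  exact sub_eq_zero.1 (norm_eq_zero.1 h4)

theorem isInvertible_fderiv_curveDefect [CompleteSpace E] {f : C(E, E)} (hf : ContDiff ℝ ∞ f)
    {K : NNReal} (hK : LipschitzWith K f) {x : E} {s : ℝ} (hs : |s| * K < 1) (γ : C(I, E)) :
    (fderiv ℝ (curveDefect f) ((x, s), γ) ∘L .inr ℝ (E × ℝ) C(I, E)).IsInvertible := by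
  have hf' : Continuous (fderiv ℝ f) := hf.continuous_fderiv (by simp)
  set A : C(I, E) →L[ℝ] C(I, E) := s • (curveIntegralL E ∘L
    curveApplyL E E ((⟨fderiv ℝ f, hf'⟩ : C(E, E →L[ℝ] E)).comp γ)) with hA
  have h1 : HasFDerivAt (fun δ => curveDefect f ((x, s), δ)) (1 - A) γ := by
    have h2 := hasFDerivAt_superposition (f' := ⟨fderiv ℝ f, hf'⟩)
        (fun x => (hf.differentiable (by simp) x).hasFDerivAt) γ
    have h3 := ((curveIntegralL E).hasFDerivAt.comp γ h2).const_smul s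
    exact ((hasFDerivAt_id γ).sub_const (curveConstL E x)).sub h3
  have h2 : HasFDerivAt (fun δ => curveDefect f ((x, s), δ))
      (fderiv ℝ (curveDefect f) ((x, s), γ) ∘L .inr ℝ (E × ℝ) C(I, E)) γ := by
    have h3 : HasFDerivAt (fun δ : C(I, E) => ((x, s), δ)) (.inr ℝ (E × ℝ) C(I, E)) γ :=
      hasFDerivAt_prodMk_right _ _
    exact ((contDiff_curveDefect f hf).differentiable (by simp) _).hasFDerivAt.comp γ h3
  rw [h2.unique h1]
  have h4 : ‖A‖ < 1 := by
    refine lt_of_le_of_lt ?_ hs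
    refine ContinuousLinearMap.opNorm_le_bound _ (by positivity) fun h => ?_
    rw [hA, smul_apply, norm_smul, Real.norm_eq_abs, mul_assoc]
    refine mul_le_mul_of_nonneg_left ?_ (abs_nonneg s)
    refine ((curveIntegralL E).le_of_opNorm_le norm_curveIntegralL_le _).trans ?_
    rw [one_mul]
    refine (ContinuousMap.norm_le _ (by positivity)).2 fun t => ?_
    refine le_trans ((fderiv ℝ f (γ t)).le_opNorm (h t)) ?_
    exact mul_le_mul (norm_fderiv_le_of_lipschitz ℝ hK) (h.norm_coe_le_norm t) (norm_nonneg _) K.2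
  obtain ⟨u, hu⟩ := isUnit_one_sub_of_norm_lt_one (R := C(I, E) →L[ℝ] C(I, E)) h4
  exact ⟨ContinuousLinearEquiv.unitsEquiv ℝ C(I, E) u, hu⟩

end Superposition

section Flow

open scoped Topology unitInterval NNReal

universe u
variable {E : Type u} [NormedAddCommGroup E] [NormedSpace ℝ E]

/-- `Φ` is the flow of the vector field `f`: a one-parameter group of maps whose orbits are the
integral curves of `f`. -/
structure IsFlow (f : E → E) (Φ : ℝ → E → E) : Prop where
  zero : ∀ x, Φ 0 x = x
  hasDerivAt : ∀ t x, HasDerivAt (fun s => Φ s x) (f (Φ t x)) t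
  add : ∀ s t x, Φ (s + t) x = Φ s (Φ t x)

/-- A bounded Lipschitz vector field has global integral curves. -/
theorem exists_integralCurve [CompleteSpace E] {f : E → E} {K L : ℝ≥0} (hK : LipschitzWith K f)
    (hL : ∀ x, ‖f x‖ ≤ L) (x : E) : ∃ γ : ℝ → E, γ 0 = x ∧ ∀ t, HasDerivAt γ (f (γ t)) t := by
  have hloc : ∀ T : ℝ, ∃ γ : ℝ → E, γ 0 = x ∧
      (0 < T → ∀ t ∈ Ioo (-T) T, HasDerivAt γ (f (γ t)) t) := by
    intro T
    rcases le_or_gt T 0 with hT | hT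
    · exact ⟨fun _ => x, rfl, fun h => absurd h hT.not_gt⟩
    have h0 : (0 : ℝ) ∈ Icc (-T) T := ⟨by linarith, hT.le⟩
    have hpl : IsPicardLindelof (fun _ => f) (⟨0, h0⟩ : Icc (-T) T) x (L * T.toNNReal) 0 L K :=
      { lipschitzOnWith := fun _ _ => hK.lipschitzOnWith
        continuousOn := fun _ _ => continuousOn_const
        norm_le := fun _ _ y _ => hL y
        mul_max_le := by simp [hT.le] }
    obtain ⟨γ, hγ0, hγ⟩ := hpl.exists_eq_forall_mem_Icc_hasDerivWithinAt₀
    exact ⟨γ, hγ0, fun _ t ht => (hγ t (Ioo_subset_Icc_self ht)).hasDerivAt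
      (Icc_mem_nhds ht.1 ht.2)⟩
  choose γ hγ0 hγ using hloc
  have huniq : ∀ S T : ℝ, 0 < S → S ≤ T → EqOn (γ S) (γ T) (Ioo (-S) S) := by
    intro S T hS hST
    refine ODE_solution_unique_of_mem_Ioo (v := fun _ => f) (s := fun _ => univ) (K := K) (t₀ := 0)
      (fun t _ => hK.lipschitzOnWith) ⟨by linarith, hS⟩ (fun t ht => ⟨hγ S hS t ht, mem_univ _⟩)
      (fun t ht => ⟨hγ T (by linarith) t ⟨by linarith [ht.1], by linarith [ht.2]⟩, mem_univ _⟩) ?_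
    rw [hγ0, hγ0]
  refine ⟨fun t => γ (|t| + 1) t, hγ0 _, fun t => ?_⟩
  have hT : 0 < |t| + 2 := by positivity
  have h1 : HasDerivAt (γ (|t| + 2)) (f (γ (|t| + 2) t)) t :=
    hγ _ hT t ⟨by linarith [neg_abs_le t], by linarith [le_abs_self t]⟩
  have h2 : γ (|t| + 1) t = γ (|t| + 2) t :=
    huniq _ _ (by positivity) (by linarith) ⟨by linarith [neg_abs_le t], by linarith [le_abs_self t]⟩
  simp only [h2]
  refine h1.congr_of_eventuallyEq ?_
  have h3 : ∀ᶠ s in 𝓝 t, |s| < |t| + 1 :=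
    (continuous_abs.tendsto t).eventually_lt_const (by linarith)
  filter_upwards [h3] with s hs
  exact huniq _ _ (by positivity) (by linarith) ⟨by linarith [neg_abs_le s], by linarith [le_abs_self s]⟩

theorem exists_isFlow [CompleteSpace E] {f : E → E} {K L : ℝ≥0} (hK : LipschitzWith K f)
    (hL : ∀ x, ‖f x‖ ≤ L) : ∃ Φ, IsFlow f Φ := by
  choose γ hγ0 hγ using exists_integralCurve hK hL
  refine ⟨fun t x => γ x t, hγ0, fun t x => hγ x t, fun s t x => ?_⟩
  have : (fun s => γ x (s + t)) = γ (γ x t) := by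
    refine ODE_solution_unique_univ (v := fun _ => f) (s := fun _ => univ) (K := K) (t₀ := 0)
      (fun t => hK.lipschitzOnWith) (fun s => ⟨?_, mem_univ _⟩)
      (fun s => ⟨hγ _ s, mem_univ _⟩) ?_
    · exact (hγ x (s + t)).comp_add_const s t
    · simp [hγ0]
  exact congrFun this s

/-- The integral curves of a vector field, rescaled to unit time, solve `γ = x + s ∫ f(γ)`. -/
theorem curveDefect_eq_zero [CompleteSpace E] {f : C(E, E)} {c : ℝ → E} {x : E} {s : ℝ}
    (h0 : c 0 = x) (hc : ∀ t, HasDerivAt c (f (c t)) t) {γ : C(I, E)}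
    (hγ : ∀ t : I, γ t = c (s * t)) : curveDefect f ((x, s), γ) = 0 := by
  ext t
  have hcont : Continuous c := continuous_iff_continuousAt.2 fun t => (hc t).continuousAt
  have h1 : ∫ τ in (0 : ℝ)..t, s • f (c (s * τ)) = c (s * t) - c (s * 0) := by
    refine intervalIntegral.integral_eq_sub_of_hasDerivAt (f := fun τ => c (s * τ)) (fun τ _ => ?_)
      (Continuous.intervalIntegrable (by fun_prop) _ _)
    have := (hc (s * τ)).scomp τ ((hasDerivAt_id τ).const_mul s)
    simpa [Function.comp_def] using this
  have h2 : curveIntegralL E (f.comp γ) t = ∫ τ in (0 : ℝ)..t, f (c (s * τ)) := by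
    rw [curveIntegralL_apply]
    refine intervalIntegral.integral_congr fun τ hτ => ?_
    rw [uIcc_of_le t.2.1] at hτ
    have hτ' : τ ∈ Icc (0 : ℝ) 1 := ⟨hτ.1, hτ.2.trans t.2.2⟩
    simp only [ContinuousMap.comp_apply, projIcc_of_mem zero_le_one hτ', hγ]
  rw [intervalIntegral.integral_smul, mul_zero, h0] at h1
  simp only [curveDefect, ContinuousMap.sub_apply, ContinuousMap.smul_apply, curveConstL_apply, h2,
    ContinuousMap.zero_apply]
  rw [h1, hγ]
  abel

theorem IsFlow.contDiffAt_of_small [CompleteSpace E] {f : E → E} {Φ : ℝ → E → E}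
    (hΦ : IsFlow f Φ) (hf : ContDiff ℝ ∞ f) {K : ℝ≥0} (hK : LipschitzWith K f) {s : ℝ}
    (hs : |s| * K < 1) (x : E) : ContDiffAt ℝ ∞ (fun q : E × ℝ => Φ q.2 q.1) (x, s) := by
  set F : C(E, E) := ⟨f, hf.continuous⟩ with hF
  have hcont : ∀ x, Continuous (fun t => Φ t x) := fun x =>
    continuous_iff_continuousAt.2 fun t => (hΦ.hasDerivAt t x).continuousAt
  let γ : E × ℝ → C(I, E) := fun q => ⟨fun t => Φ (q.2 * t) q.1, by
    have := hcont q.1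
    fun_prop⟩
  have hγ : ∀ q, curveDefect F (q, γ q) = 0 := fun q =>
    curveDefect_eq_zero (c := fun t => Φ t q.1) (hΦ.zero q.1) (fun t => hΦ.hasDerivAt t q.1)
      (fun t => rfl)
  have hG : ContDiffAt ℝ ∞ (curveDefect F) ((x, s), γ (x, s)) :=
    (contDiff_curveDefect F hf).contDiffAt
  have hinv := isInvertible_fderiv_curveDefect (f := F) hf hK (x := x) hs (γ (x, s))
  have hn : (∞ : WithTop ℕ∞) ≠ 0 := by simp
  have h1 := hG.eventually_apply_implicitFunction hn hinv
  have h2 := hG.contDiffAt_implicitFunction hn hinv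
  have h3 : ∀ᶠ q : E × ℝ in 𝓝 (x, s), |q.2| * K < 1 :=
    ((continuous_abs.comp continuous_snd).mul continuous_const).tendsto (x, s)
      |>.eventually_lt_const hs
  have h4 : ContDiffAt ℝ ∞ γ (x, s) := by
    refine h2.congr_of_eventuallyEq ?_
    filter_upwards [h1, h3] with q hq1 hq2
    refine (eq_of_curveDefect_eq (f := F) hK hq2 (x := q.1) ?_).symm
    rw [hγ] at hq1
    exact hq1.trans (hγ q).symm
  have h5 : ContDiff ℝ ∞ (fun g : C(I, E) => g 1) :=
    ContinuousLinearMap.contDiff (E := C(I, E)) (F := E) (ContinuousMap.evalCLM ℝ (1 : I))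
  refine (h5.contDiffAt.comp (x, s) h4).congr_of_eventuallyEq (Filter.Eventually.of_forall fun q => ?_)
  simp [γ]

/-- The flow of a smooth Lipschitz vector field is smooth. -/
theorem IsFlow.contDiff [CompleteSpace E] {f : E → E} {Φ : ℝ → E → E}
    (hΦ : IsFlow f Φ) (hf : ContDiff ℝ ∞ f) {K : ℝ≥0} (hK : LipschitzWith K f) :
    ContDiff ℝ ∞ (fun q : ℝ × E => Φ q.1 q.2) := by
  have hiter : ∀ (n : ℕ) (s : ℝ) (x : E), |s| * K < 1 + n →
      ContDiffAt ℝ ∞ (fun q : ℝ × E => Φ q.1 q.2) (s, x) := by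
    intro n
    induction n with
    | zero =>
      intro s x hs
      exact (hΦ.contDiffAt_of_small hf hK (by simpa using hs) x).comp (s, x)
        (contDiff_snd.prodMk contDiff_fst).contDiffAt
    | succ n ih =>
      intro s x hs
      set a : ℝ := 1 / (n + 2) with ha
      have hn : (0 : ℝ) < n + 2 := by positivity
      have ha0 : 0 ≤ a := by positivity
      have ha1 : 1 - a = (n + 1) / (n + 2) := by rw [ha]; field_simp; ring
      push_cast at hs
      have hs1 : |a * s| * K < 1 := by
        rw [abs_mul, abs_of_nonneg ha0, mul_assoc, ha, one_div, inv_mul_lt_iff₀ hn]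
        linarith
      have hs2 : |(1 - a) * s| * K < 1 + n := by
        rw [abs_mul, ha1, abs_of_nonneg (by positivity), mul_assoc, div_mul_eq_mul_div,
          div_lt_iff₀ hn]
        nlinarith
      have h1 : (fun q : ℝ × E => Φ q.1 q.2) =
          fun q => Φ (a * q.1) (Φ ((1 - a) * q.1) q.2) := by
        ext q
        rw [← hΦ.add]
        congr 1
        ring
      rw [h1]
      have h2 : ContDiffAt ℝ ∞ (fun q : ℝ × E => Φ ((1 - a) * q.1) q.2) (s, x) :=
        (ih ((1 - a) * s) x hs2).comp (s, x)
          (f := fun q : ℝ × E => ((1 - a) * q.1, q.2)) (by fun_prop)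
      have h3 := hΦ.contDiffAt_of_small hf hK hs1 (Φ ((1 - a) * s) x)
      exact h3.comp (s, x) (f := fun q : ℝ × E => (Φ ((1 - a) * q.1) q.2, a * q.1))
        (h2.prodMk (by fun_prop))
  refine contDiff_iff_contDiffAt.2 fun q => ?_
  obtain ⟨n, hn⟩ := exists_nat_gt (|q.1| * K)
  exact hiter n q.1 q.2 (by linarith)

/-- A compactly supported smooth vector field on a finite-dimensional space has a smooth flow. -/
theorem exists_smooth_isFlow [FiniteDimensional ℝ E] {f : E → E}
    (hf : ContDiff ℝ ∞ f) (hfc : HasCompactSupport f) :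
    ∃ Φ, IsFlow f Φ ∧ ContDiff ℝ ∞ (fun q : ℝ × E => Φ q.1 q.2) := by
  have : CompleteSpace E := FiniteDimensional.complete ℝ E
  obtain ⟨K, hK⟩ := hf.lipschitzWith_of_hasCompactSupport hfc (by simp)
  obtain ⟨C, hC⟩ := hf.continuous.bounded_above_of_compact_support hfc
  obtain ⟨Φ, hΦ⟩ := exists_isFlow (L := C.toNNReal) hK (fun x => (hC x).trans (Real.le_coe_toNNReal C))
  exact ⟨Φ, hΦ, hΦ.contDiff hf hK⟩

theorem IsFlow.neg_apply {f : E → E} {Φ : ℝ → E → E} (hΦ : IsFlow f Φ) (t : ℝ) (x : E) :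
    Φ (-t) (Φ t x) = x := by
  rw [← hΦ.add, neg_add_cancel, hΦ.zero]

theorem IsFlow.apply_neg {f : E → E} {Φ : ℝ → E → E} (hΦ : IsFlow f Φ) (t : ℝ) (x : E) :
    Φ t (Φ (-t) x) = x := by
  rw [← hΦ.add, add_neg_cancel, hΦ.zero]

theorem IsFlow.apply_eq_self {f : E → E} {Φ : ℝ → E → E} (hΦ : IsFlow f Φ) {K : ℝ≥0}
    (hK : LipschitzWith K f) {x : E} (hx : f x = 0) (t : ℝ) : Φ t x = x := by
  have : (fun t => Φ t x) = fun _ => x := by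
    refine ODE_solution_unique_univ (v := fun _ => f) (s := fun _ => univ) (K := K) (t₀ := 0)
      (fun t => hK.lipschitzOnWith) (fun s => ⟨hΦ.hasDerivAt s x, mem_univ _⟩)
      (fun s => ⟨?_, mem_univ _⟩) (hΦ.zero x)
    simpa only [hx] using hasDerivAt_const s x
  exact congrFun this t

theorem IsFlow.mem_tsupport_iff {f : E → E} {Φ : ℝ → E → E} (hΦ : IsFlow f Φ) {K : ℝ≥0}
    (hK : LipschitzWith K f) (t : ℝ) (x : E) : Φ t x ∈ tsupport f ↔ x ∈ tsupport f := by
  have key : ∀ t x, x ∉ tsupport f → Φ t x = x := fun t x hx =>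
    hΦ.apply_eq_self hK (image_eq_zero_of_notMem_tsupport hx) t
  constructor
  · intro h
    by_contra hx
    rw [key t x hx] at h
    exact hx h
  · intro h
    by_contra hx
    have h1 := key (-t) _ hx
    rw [hΦ.neg_apply] at h1
    rw [← h1] at hx
    exact hx h

/-- The flow of `c • f` is a time change of the flow of `f`. -/
theorem IsFlow.smul {f : E → E} {Φ : ℝ → E → E} (hΦ : IsFlow f Φ) (c : ℝ) :
    IsFlow (c • f) (fun t => Φ (c * t)) where
  zero x := by simp [hΦ.zero]
  hasDerivAt t x := by
    have := (hΦ.hasDerivAt (c * t) x).scomp t ((hasDerivAt_id t).const_mul c)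
    simpa [Function.comp_def] using this
  add s t x := by rw [mul_add, hΦ.add]

/-- The linearised flow solves the variational equation. -/
theorem IsFlow.hasDerivAt_fderiv {f : E → E} {Φ : ℝ → E → E} (hΦ : IsFlow f Φ)
    (hf : ContDiff ℝ ∞ f) (hsm : ContDiff ℝ ∞ (fun q : ℝ × E => Φ q.1 q.2)) (t : ℝ) (x v : E) :
    HasDerivAt (fun s => fderiv ℝ (Φ s) x v) (fderiv ℝ f (Φ t x) (fderiv ℝ (Φ t) x v)) t := by
  set Ψ : ℝ × E → E := fun q => Φ q.1 q.2 with hΨ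
  have hd : Differentiable ℝ Ψ := hsm.differentiable (by simp)
  have hd2 : Differentiable ℝ (fderiv ℝ Ψ) :=
    (hsm.fderiv_right (m := ∞) (by simp)).differentiable (by simp)
  have hx : ∀ s y w, fderiv ℝ (Φ s) y w = fderiv ℝ Ψ (s, y) (0, w) := by
    intro s y w
    have h1 : HasFDerivAt (fun y => Ψ (s, y)) (fderiv ℝ Ψ (s, y) ∘L .inr ℝ ℝ E) y :=
      (hd (s, y)).hasFDerivAt.comp y (hasFDerivAt_prodMk_right s y)
    rw [show Φ s = fun y => Ψ (s, y) from rfl, h1.fderiv]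
    rfl
  have ht : ∀ s y, fderiv ℝ Ψ (s, y) (1, 0) = f (Φ s y) := by
    intro s y
    have h1 : HasFDerivAt (fun s => Ψ (s, y)) (fderiv ℝ Ψ (s, y) ∘L .inl ℝ ℝ E) s :=
      HasFDerivAt.comp s (g := Ψ) (f := fun s => (s, y)) (hd (s, y)).hasFDerivAt
        (hasFDerivAt_prodMk_left s y)
    have h2 := h1.hasDerivAt.unique (hΦ.hasDerivAt s y)
    rw [← h2]
    rfl
  have h1 : HasDerivAt (fun s => fderiv ℝ (Φ s) x v)
      (fderiv ℝ (fderiv ℝ Ψ) (t, x) (1, 0) (0, v)) t := by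
    simp only [hx]
    have h2 : HasFDerivAt (fun s => fderiv ℝ Ψ (s, x))
        (fderiv ℝ (fderiv ℝ Ψ) (t, x) ∘L .inl ℝ ℝ E) t :=
      (hd2 (t, x)).hasFDerivAt.comp t (hasFDerivAt_prodMk_left t x)
    have h3 := h2.hasDerivAt.clm_apply (hasDerivAt_const t ((0 : ℝ), v))
    simpa using h3
  have hsymm : fderiv ℝ (fderiv ℝ Ψ) (t, x) (1, 0) (0, v) =
      fderiv ℝ (fderiv ℝ Ψ) (t, x) (0, v) (1, 0) :=
    (hsm.contDiffAt.isSymmSndFDerivAt (by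
      rw [minSmoothness_of_isRCLikeNormedField]
      exact WithTop.coe_le_coe.2 (le_top (a := (2 : ℕ∞))))) _ _
  have h4 : fderiv ℝ (fderiv ℝ Ψ) (t, x) (0, v) (1, 0) =
      fderiv ℝ f (Φ t x) (fderiv ℝ (Φ t) x v) := by
    have h5 : HasFDerivAt (fun q => fderiv ℝ Ψ q (1, 0))
        ((fderiv ℝ f (Ψ (t, x))) ∘L fderiv ℝ Ψ (t, x)) (t, x) := by
      have h6 : (fun q => fderiv ℝ Ψ q (1, 0)) = f ∘ Ψ := by
        ext q
        exact ht q.1 q.2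
      rw [h6]
      exact (hf.differentiable (by simp) _).hasFDerivAt.comp (t, x) (hd (t, x)).hasFDerivAt
    have h7 := (hd2 (t, x)).hasFDerivAt.clm_apply (hasFDerivAt_const ((1 : ℝ), (0 : E)) (t, x))
    have h8 := congrArg (fun A => A (0, v)) (h7.unique h5)
    simp only [ContinuousLinearMap.comp_zero, zero_add, ContinuousLinearMap.flip_apply,
      ContinuousLinearMap.comp_apply] at h8
    rw [h8, hx]
  rw [← h4, ← hsymm]
  exact h1

end Flow

section LocalContact

open scoped Topology NNReal

universe u
variable {E : Type u} [NormedAddCommGroup E] [NormedSpace ℝ E]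

/-- A contact form on an open subset `U` of a vector space. -/
structure IsLocalContactForm (a : E → E →L[ℝ] ℝ) (U : Set E) : Prop where
  isOpen : IsOpen U
  contDiffOn : ContDiffOn ℝ ∞ a U
  ne_zero : ∀ u ∈ U, a u ≠ 0
  nondegenerate : ∀ u ∈ U, ∀ v, a u v = 0 →
    (∀ w, a u w = 0 → fderiv ℝ a u v w - fderiv ℝ a u w v = 0) → v = 0

/-- The bilinear form `dα + α ⊗ α`. -/
def contactPairing (a : E → E →L[ℝ] ℝ) (u : E) : E →L[ℝ] E →L[ℝ] ℝ :=
  fderiv ℝ a u - (fderiv ℝ a u).flip + (a u).smulRight (a u)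

theorem contactPairing_apply (a : E → E →L[ℝ] ℝ) (u v w : E) :
    contactPairing a u v w = fderiv ℝ a u v w - fderiv ℝ a u w v + a u v * a u w := by
  simp [contactPairing]

/-- The Reeb vector of the contact form `a` at `u`. -/
def reebVector (a : E → E →L[ℝ] ℝ) (u : E) : E := (contactPairing a u).inverse (a u)

/-- The value at `u` of the contact vector field of a Hamiltonian with value `h` and derivative `η`
at `u`. -/
def contactVector (a : E → E →L[ℝ] ℝ) (u : E) (h : ℝ) (η : E →L[ℝ] ℝ) : E :=
  h • reebVector a u + (contactPairing a u).inverse (η (reebVector a u) • a u - η)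

namespace IsLocalContactForm

variable {a : E → E →L[ℝ] ℝ} {U : Set E} (ha : IsLocalContactForm a U)
include ha

theorem contDiffAt {u : E} (hu : u ∈ U) : ContDiffAt ℝ ∞ a u :=
  ha.contDiffOn.contDiffAt (ha.isOpen.mem_nhds hu)

theorem contDiffAt_fderiv {u : E} (hu : u ∈ U) : ContDiffAt ℝ ∞ (fderiv ℝ a) u :=
  (ha.contDiffAt hu).fderiv_right (by simp)

theorem contDiffAt_contactPairing {u : E} (hu : u ∈ U) :
    ContDiffAt ℝ ∞ (contactPairing a) u := by
  have h1 := ha.contDiffAt_fderiv hu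
  have hflip : ContDiff ℝ ∞ (fun B : E →L[ℝ] E →L[ℝ] ℝ => B.flip) :=
    IsBoundedLinearMap.contDiff (IsLinearMap.with_bound
      ⟨fun B C => by ext; simp, fun c B => by ext; simp⟩ 1 fun B => by
        rw [ContinuousLinearMap.opNorm_flip, one_mul])
  have h2 : ContDiffAt ℝ ∞ (fun u => (fderiv ℝ a u).flip) u := hflip.contDiffAt.comp u h1
  have h3 : ContDiffAt ℝ ∞ (fun u => (a u).smulRight (a u)) u :=
    (ha.contDiffAt hu).smulRight (ha.contDiffAt hu)
  exact (h1.sub h2).add h3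

theorem isInvertible_contactPairing [FiniteDimensional ℝ E] {u : E} (hu : u ∈ U) :
    (contactPairing a u).IsInvertible := by
  have hinj : Function.Injective (contactPairing a u : E →ₗ[ℝ] E →L[ℝ] ℝ) := by
    rw [injective_iff_map_eq_zero]
    intro v hv
    have hv' : ∀ w, contactPairing a u v w = 0 := fun w => congrArg (fun η => η w) hv
    have h1 : a u v = 0 := by
      have := hv' v
      rw [contactPairing_apply, sub_self, zero_add] at this
      exact mul_self_eq_zero.1 this
    refine ha.nondegenerate u hu v h1 fun w hw => ?_
    have := hv' w
    rwa [contactPairing_apply, h1, zero_mul, add_zero] at this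
  have hdim : Module.finrank ℝ E = Module.finrank ℝ (E →L[ℝ] ℝ) := by
    rw [← (LinearMap.toContinuousLinearMap (𝕜 := ℝ) (E := E) (F' := ℝ)).finrank_eq]
    exact (Subspace.dual_finrank_eq).symm
  refine ⟨(LinearEquiv.ofInjectiveOfFinrankEq (contactPairing a u : E →ₗ[ℝ] E →L[ℝ] ℝ) hinj
    hdim).toContinuousLinearEquiv, ?_⟩
  ext v w
  rfl

variable [FiniteDimensional ℝ E]

theorem contactPairing_reebVector {u : E} (hu : u ∈ U) :
    contactPairing a u (reebVector a u) = a u :=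
  (ha.isInvertible_contactPairing hu).self_apply_inverse _

theorem apply_reebVector {u : E} (hu : u ∈ U) : a u (reebVector a u) = 1 := by
  have h := fun w => congrArg (fun η => η w) (ha.contactPairing_reebVector hu)
  simp only [contactPairing_apply] at h
  have h1 := h (reebVector a u)
  rw [sub_self, zero_add] at h1
  have h0 : a u (reebVector a u) * (a u (reebVector a u) - 1) = 0 := by linarith
  rcases mul_eq_zero.1 h0 with h2 | h2
  · exfalso
    have h3 : reebVector a u = 0 := ha.nondegenerate u hu _ h2 fun w hw => by
      have := h w
      rwa [h2, zero_mul, add_zero, hw] at this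
    have h4 := ha.contactPairing_reebVector hu
    rw [h3, map_zero] at h4
    exact ha.ne_zero u hu h4.symm
  · linarith

theorem fderiv_reebVector {u : E} (hu : u ∈ U) (w : E) :
    fderiv ℝ a u (reebVector a u) w - fderiv ℝ a u w (reebVector a u) = 0 := by
  have h := congrArg (fun η => η w) (ha.contactPairing_reebVector hu)
  simp only [contactPairing_apply, ha.apply_reebVector hu, one_mul] at h
  linarith

theorem apply_contactVector {u : E} (hu : u ∈ U) (h : ℝ) (η : E →L[ℝ] ℝ) :
    a u (contactVector a u h η) = h ∧
    ∀ w, fderiv ℝ a u (contactVector a u h η) w - fderiv ℝ a u w (contactVector a u h η) =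
      η (reebVector a u) * a u w - η w := by
  set Y := (contactPairing a u).inverse (η (reebVector a u) • a u - η) with hY
  have h1 : ∀ w, fderiv ℝ a u Y w - fderiv ℝ a u w Y + a u Y * a u w =
      η (reebVector a u) * a u w - η w := by
    intro w
    rw [← contactPairing_apply, hY, (ha.isInvertible_contactPairing hu).self_apply_inverse]
    simp
  have h2 : a u Y = 0 := by
    have h3 := h1 (reebVector a u)
    have h4 := ha.fderiv_reebVector hu Y
    rw [ha.apply_reebVector hu] at h3
    linarith
  have h5 : contactVector a u h η = h • reebVector a u + Y := rfl
  rw [h5]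
  refine ⟨by simp [ha.apply_reebVector hu, h2], fun w => ?_⟩
  have h6 := h1 w
  have h7 := ha.fderiv_reebVector hu w
  simp only [map_add, map_smul, add_apply, smul_apply, smul_eq_mul]
  rw [h2] at h6
  linear_combination h6 + h * h7

theorem contDiffAt_reebVector {u : E} (hu : u ∈ U) : ContDiffAt ℝ ∞ (reebVector a) u := by
  have : CompleteSpace E := FiniteDimensional.complete ℝ E
  exact (((ha.isInvertible_contactPairing hu).contDiffAt_map_inverse).comp u
    (ha.contDiffAt_contactPairing hu)).clm_apply (ha.contDiffAt hu)

theorem contDiffAt_contactVector {P : Type*} [NormedAddCommGroup P] [NormedSpace ℝ P] {q : P}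
    {u : P → E} {h : P → ℝ} {η : P → E →L[ℝ] ℝ} (hq : u q ∈ U) (hu : ContDiffAt ℝ ∞ u q)
    (hh : ContDiffAt ℝ ∞ h q) (hη : ContDiffAt ℝ ∞ η q) :
    ContDiffAt ℝ ∞ (fun p => contactVector a (u p) (h p) (η p)) q := by
  have : CompleteSpace E := FiniteDimensional.complete ℝ E
  have hR := (ha.contDiffAt_reebVector hq).comp q hu
  have hi := ((ha.isInvertible_contactPairing hq).contDiffAt_map_inverse (n := ∞)).comp q
    ((ha.contDiffAt_contactPairing hq).comp q hu)
  have ha' := (ha.contDiffAt hq).comp q hu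
  exact (hh.smul hR).add (hi.clm_apply (((hη.clm_apply hR).smul ha').sub hη))

end IsLocalContactForm

/-- The contact vector field of the Hamiltonian `H`. -/
def contactField (a : E → E →L[ℝ] ℝ) (H : E → ℝ) (u : E) : E :=
  contactVector a u (H u) (fderiv ℝ H u)

/-- A compactly supported vector field that preserves `ker a`. -/
structure IsContactField (a : E → E →L[ℝ] ℝ) (U : Set E) (X : E → E) : Prop where
  contDiff : ContDiff ℝ ∞ X
  hasCompactSupport : HasCompactSupport X
  tsupport_subset : tsupport X ⊆ U
  lieDeriv : ∃ μ : E → ℝ, ContinuousOn μ U ∧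
    ∀ u ∈ U, ∀ v, fderiv ℝ a u (X u) v + a u (fderiv ℝ X u v) = μ u * a u v

theorem contactField_eq_zero {a : E → E →L[ℝ] ℝ} {H : E → ℝ} {u : E} (hu : u ∉ tsupport H) :
    contactField a H u = 0 := by
  have h1 : H u = 0 := image_eq_zero_of_notMem_tsupport hu
  have h2 : fderiv ℝ H u = 0 := image_eq_zero_of_notMem_tsupport
    (fun h => hu (tsupport_fderiv_subset ℝ h))
  simp [contactField, contactVector, h1, h2]

theorem tsupport_contactField_subset (a : E → E →L[ℝ] ℝ) (H : E → ℝ) :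
    tsupport (contactField a H) ⊆ tsupport H := by
  refine closure_minimal (fun u hu => ?_) (isClosed_tsupport H)
  by_contra h
  exact hu (contactField_eq_zero h)

theorem IsLocalContactForm.isContactField [FiniteDimensional ℝ E] {a : E → E →L[ℝ] ℝ} {U : Set E}
    (ha : IsLocalContactForm a U) {H : E → ℝ} (hH : ContDiff ℝ ∞ H) (hHc : HasCompactSupport H)
    (hHU : tsupport H ⊆ U) : IsContactField a U (contactField a H) := by
  have hH' : ContDiff ℝ ∞ (fderiv ℝ H) := hH.fderiv_right (by simp)
  have hsm : ContDiff ℝ ∞ (contactField a H) := by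
    refine contDiff_iff_contDiffAt.2 fun u => ?_
    by_cases hu : u ∈ U
    · exact ha.contDiffAt_contactVector hu contDiffAt_id hH.contDiffAt hH'.contDiffAt
    · have h1 : (tsupport H)ᶜ ∈ 𝓝 u :=
        (isClosed_tsupport H).isOpen_compl.mem_nhds fun h => hu (hHU h)
      refine (contDiffAt_const (c := (0 : E))).congr_of_eventuallyEq ?_
      filter_upwards [h1] with w hw
      exact contactField_eq_zero hw
  refine ⟨hsm, hHc.mono' ((subset_tsupport _).trans (tsupport_contactField_subset a H)),
    (tsupport_contactField_subset a H).trans hHU, fun u => fderiv ℝ H u (reebVector a u), ?_, ?_⟩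
  · intro u hu
    exact (hH'.continuous.continuousAt.clm_apply
      (ha.contDiffAt_reebVector hu).continuousAt).continuousWithinAt
  · intro u hu v
    have h1 : HasFDerivAt (fun u => a u (contactField a H u)) _ u :=
      ((ha.contDiffAt hu).differentiableAt (by simp)).hasFDerivAt.clm_apply
        (hsm.differentiable (by simp) u).hasFDerivAt
    have h2 : HasFDerivAt (fun u => a u (contactField a H u)) (fderiv ℝ H u) u := by
      refine (hH.differentiable (by simp) u).hasFDerivAt.congr_of_eventuallyEq ?_
      filter_upwards [ha.isOpen.mem_nhds hu] with w hw
      exact (ha.apply_contactVector hw _ _).1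
    have h3 := congrArg (fun η => η v) (h1.unique h2)
    have h4 := (ha.apply_contactVector hu (H u) (fderiv ℝ H u)).2 v
    simp only [add_apply, ContinuousLinearMap.comp_apply, ContinuousLinearMap.flip_apply] at h3
    change fderiv ℝ a u (contactVector a u (H u) (fderiv ℝ H u)) v + _ = _
    change a u (fderiv ℝ (contactField a H) u v) +
      fderiv ℝ a u v (contactVector a u (H u) (fderiv ℝ H u)) = _ at h3
    linarith

theorem IsContactField.smul {a : E → E →L[ℝ] ℝ} {U : Set E} {X : E → E}
    (hX : IsContactField a U X) (c : ℝ) : IsContactField a U (c • X) := by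
  have hs : tsupport (c • X) ⊆ tsupport X := tsupport_smul_subset_right (fun _ => c) X
  obtain ⟨μ, hμ, h⟩ := hX.lieDeriv
  refine ⟨contDiff_const.smul hX.contDiff, hX.hasCompactSupport.mono' ((subset_tsupport _).trans hs),
    hs.trans hX.tsupport_subset, fun u => c * μ u, continuousOn_const.mul hμ, fun u hu v => ?_⟩
  rw [fderiv_const_smul (hX.contDiff.differentiable (by simp) u)]
  simp only [Pi.smul_apply, map_smul, smul_apply, smul_eq_mul]
  linear_combination c * h u hu v

theorem IsContactField.exists_lipschitzWith [FiniteDimensional ℝ E] {a : E → E →L[ℝ] ℝ} {U : Set E}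
    {X : E → E} (hX : IsContactField a U X) : ∃ K, LipschitzWith K X :=
  hX.contDiff.lipschitzWith_of_hasCompactSupport hX.hasCompactSupport (by simp)

theorem IsContactField.flow_mem [FiniteDimensional ℝ E] {a : E → E →L[ℝ] ℝ} {U : Set E}
    {X : E → E} (hX : IsContactField a U X) {Φ : ℝ → E → E} (hΦ : IsFlow X Φ) {u : E} (hu : u ∈ U)
    (t : ℝ) : Φ t u ∈ U := by
  obtain ⟨K, hK⟩ := hX.exists_lipschitzWith
  by_cases h : u ∈ tsupport X
  · exact hX.tsupport_subset ((hΦ.mem_tsupport_iff hK t u).2 h)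
  · rwa [hΦ.apply_eq_self hK (image_eq_zero_of_notMem_tsupport h)]

/-- The flow of a contact vector field preserves `ker a`. -/
theorem IsContactField.flow_preserves [FiniteDimensional ℝ E] {a : E → E →L[ℝ] ℝ} {U : Set E}
    (ha : IsLocalContactForm a U) {X : E → E} (hX : IsContactField a U X) {Φ : ℝ → E → E}
    (hΦ : IsFlow X Φ) (hsm : ContDiff ℝ ∞ (fun q : ℝ × E => Φ q.1 q.2)) {u v : E} (hu : u ∈ U)
    (hv : a u v = 0) (t : ℝ) : a (Φ t u) (fderiv ℝ (Φ t) u v) = 0 := by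
  wlog ht : 0 ≤ t generalizing t X Φ
  · have h1 := this (hX.smul (-1)) (hΦ.smul (-1))
      (hsm.comp ((contDiff_const.mul contDiff_fst).prodMk contDiff_snd)) (-t) (by linarith)
    simpa using h1
  obtain ⟨μ, hμ, hL⟩ := hX.lieDeriv
  have hmem := hX.flow_mem hΦ hu
  set c : ℝ → ℝ := fun s => a (Φ s u) (fderiv ℝ (Φ s) u v) with hc
  have hcd : ∀ s, HasDerivAt c (μ (Φ s u) * c s) s := by
    intro s
    have h1 : HasDerivAt (fun s => a (Φ s u)) (fderiv ℝ a (Φ s u) (X (Φ s u))) s :=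
      ((ha.contDiffAt (hmem s)).differentiableAt (by simp)).hasFDerivAt.comp_hasDerivAt s
        (hΦ.hasDerivAt s u)
    have h2 := h1.clm_apply (hΦ.hasDerivAt_fderiv hX.contDiff hsm s u v)
    rw [hL _ (hmem s)] at h2
    exact h2
  have hcont : Continuous (fun s => Φ s u) :=
    continuous_iff_continuousAt.2 fun t => (hΦ.hasDerivAt t u).continuousAt
  have hμc : Continuous (fun s => μ (Φ s u)) := hμ.comp_continuous hcont hmem
  obtain ⟨C, hC⟩ := (isCompact_Icc (a := (0 : ℝ)) (b := t)).exists_bound_of_continuousOn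
    hμc.continuousOn
  refine eq_zero_of_abs_deriv_le_mul_abs_self_of_eq_zero_right (f := c) (K := C)
    (fun s _ => (hcd s).continuousAt.continuousWithinAt) (fun s _ => (hcd s).hasDerivWithinAt) ?_
    (fun s hs => ?_) t ⟨ht, le_rfl⟩
  · have h0 : Φ 0 = id := funext hΦ.zero
    simp [hc, h0, hv]
  · rw [norm_mul]
    exact mul_le_mul_of_nonneg_right (hC s ⟨hs.1, hs.2.le⟩) (norm_nonneg _)

end LocalContact

section Squeezing

open scoped Topology NNReal RealInnerProductSpace

universe u
variable {E : Type u} [NormedAddCommGroup E] [InnerProductSpace ℝ E]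

/-- The Hamiltonian whose contact vector field has a sink at `p`. -/
def sinkHamiltonian (a : E → E →L[ℝ] ℝ) (p u : E) : ℝ := -(a p (u - p) + a u (u - p))

theorem IsLocalContactForm.contDiffAt_sinkHamiltonian {a : E → E →L[ℝ] ℝ} {U : Set E}
    (ha : IsLocalContactForm a U) {p u : E} (hp : p ∈ U) (hu : u ∈ U) :
    ContDiffAt ℝ ∞ (Function.uncurry (sinkHamiltonian a)) (p, u) := by
  have hsub : ContDiffAt ℝ ∞ (fun q : E × E => q.2 - q.1) (p, u) := by fun_prop
  have h1 : ContDiffAt ℝ ∞ (fun q : E × E => a q.1) (p, u) :=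
    ContDiffAt.comp (p, u) (ha.contDiffAt hp) contDiffAt_fst
  have h2 : ContDiffAt ℝ ∞ (fun q : E × E => a q.2) (p, u) :=
    ContDiffAt.comp (p, u) (ha.contDiffAt hu) contDiffAt_snd
  exact ((h1.clm_apply hsub).add (h2.clm_apply hsub)).neg

theorem IsLocalContactForm.hasFDerivAt_sinkHamiltonian {a : E → E →L[ℝ] ℝ} {U : Set E}
    (ha : IsLocalContactForm a U) (p : E) {u : E} (hu : u ∈ U) :
    HasFDerivAt (sinkHamiltonian a p) (-(a p + (a u + (fderiv ℝ a u).flip (u - p)))) u := by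
  have h0 : HasFDerivAt (fun u : E => u - p) (ContinuousLinearMap.id ℝ E) u :=
    (hasFDerivAt_id u).sub_const p
  have h1 := (a p).hasFDerivAt.comp u h0
  have h2 := ((ha.contDiffAt hu).differentiableAt (by simp)).hasFDerivAt.clm_apply h0
  refine ((h1.add h2).neg).congr_fderiv ?_
  simp

variable [FiniteDimensional ℝ E]

/-- The contact vector field with a sink at `p`. -/
def sinkField (a : E → E →L[ℝ] ℝ) (q : E × E) : E := contactField a (sinkHamiltonian a q.1) q.2

theorem IsLocalContactForm.contDiffAt_sinkField {a : E → E →L[ℝ] ℝ} {U : Set E}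
    (ha : IsLocalContactForm a U) {q : E × E} (hp : q.1 ∈ U) (hu : q.2 ∈ U) :
    ContDiffAt ℝ ∞ (sinkField a) q := by
  have h := ha.contDiffAt_sinkHamiltonian hp hu
  refine ha.contDiffAt_contactVector hu contDiffAt_snd h ?_
  have h' : ContDiffAt ℝ ∞ (Function.uncurry fun q : E × E => sinkHamiltonian a q.1) (q, q.2) :=
    ContDiffAt.comp (q, q.2) (f := fun r : (E × E) × E => (r.1.1, r.2)) h (by fun_prop)
  exact h'.fderiv contDiffAt_snd (by simp)

theorem IsLocalContactForm.sinkField_self {a : E → E →L[ℝ] ℝ} {U : Set E}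
    (ha : IsLocalContactForm a U) {p : E} (hp : p ∈ U) : sinkField a (p, p) = 0 := by
  have h1 : sinkHamiltonian a p p = 0 := by simp [sinkHamiltonian]
  simp only [sinkField, contactField, contactVector, h1, zero_smul, zero_add,
    (ha.hasFDerivAt_sinkHamiltonian p hp).fderiv]
  have h2 : (-(a p + (a p + (fderiv ℝ a p).flip (p - p)))) (reebVector a p) • a p -
      -(a p + (a p + (fderiv ℝ a p).flip (p - p))) = 0 := by
    ext w
    simp [ha.apply_reebVector hp]
    ring
  rw [h2, map_zero]

/-- The linearisation of the sink at its zero. -/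
theorem IsLocalContactForm.fderiv_sinkField {a : E → E →L[ℝ] ℝ} {U : Set E}
    (ha : IsLocalContactForm a U) {x : E} (hx : x ∈ U) (v : E) :
    fderiv ℝ (sinkField a) (x, x) (0, v) = -v - a x v • reebVector a x := by
  set L := fderiv ℝ (sinkField a) (x, x) (0, v) with hL
  set c : ℝ → E := fun t => x + t • v with hc
  have hc0 : c 0 = x := by simp [hc]
  have hcd : HasDerivAt c v 0 := by
    have := ((hasDerivAt_id (0 : ℝ)).smul_const v).const_add x
    rwa [one_smul] at this
  have hcU : ∀ᶠ t in 𝓝 (0 : ℝ), c t ∈ U :=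
    hcd.continuousAt.eventually_mem (by rw [hc0]; exact ha.isOpen.mem_nhds hx)
  set Y : ℝ → E := fun t => sinkField a (x, c t) with hY
  have hY0 : Y 0 = 0 := by simp only [hY, hc0, ha.sinkField_self hx]
  have hYd : HasDerivAt Y L 0 := by
    have h1 : HasFDerivAt (sinkField a) (fderiv ℝ (sinkField a) (x, x)) (x, c 0) := by
      rw [hc0]
      exact ((ha.contDiffAt_sinkField (q := (x, x)) hx hx).differentiableAt (by simp)).hasFDerivAt
    exact h1.comp_hasDerivAt 0 ((hasDerivAt_const 0 x).prodMk hcd)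
  have had : HasDerivAt (fun t => a (c t)) (fderiv ℝ a x v) 0 := by
    have h1 : HasFDerivAt a (fderiv ℝ a x) (c 0) := by
      rw [hc0]
      exact ((ha.contDiffAt hx).differentiableAt (by simp)).hasFDerivAt
    exact h1.comp_hasDerivAt 0 hcd
  have hDd : ∃ D', HasDerivAt (fun t => fderiv ℝ a (c t)) D' 0 := by
    have h1 : HasFDerivAt (fderiv ℝ a) (fderiv ℝ (fderiv ℝ a) x) (c 0) := by
      rw [hc0]
      exact ((ha.contDiffAt_fderiv hx).differentiableAt (by simp)).hasFDerivAt
    exact ⟨_, HasFDerivAt.comp_hasDerivAt (l := fderiv ℝ a) 0 h1 hcd⟩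
  obtain ⟨D', hDd⟩ := hDd
  have hRd : ∃ R', HasDerivAt (fun t => reebVector a (c t)) R' 0 := by
    have h1 : HasFDerivAt (reebVector a) (fderiv ℝ (reebVector a) x) (c 0) := by
      rw [hc0]
      exact ((ha.contDiffAt_reebVector hx).differentiableAt (by simp)).hasFDerivAt
    exact ⟨_, h1.comp_hasDerivAt 0 hcd⟩
  obtain ⟨R', hRd⟩ := hRd
  have hcx : HasDerivAt (fun t => c t - x) v 0 := hcd.sub_const x
  -- the first equation: `a (Y) = h`
  have e1 : a x L = -(a x v + a x v) := by
    have h1 := had.clm_apply hYd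
    have h2 := (((hasDerivAt_const (0 : ℝ) (a x)).clm_apply hcx).add (had.clm_apply hcx)).neg
    have h3 := h1.congr_of_eventuallyEq (f₁ := fun t => -(a x (c t - x) + a (c t) (c t - x))) (by
      filter_upwards [hcU] with t ht
      exact (ha.apply_contactVector ht _ _).1.symm)
    have h4 := h3.unique h2
    simpa [hY0, hc0] using h4
  -- the second equation: `da (Y, w) = η (R) a (w) - η (w)`
  have e2 : ∀ w, a x w = 0 →
      fderiv ℝ a x L w - fderiv ℝ a x w L = -(fderiv ℝ a x v w - fderiv ℝ a x w v) := by
    intro w hw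
    have hw' := hasDerivAt_const (0 : ℝ) w
    have h1 := ((hDd.clm_apply hYd).clm_apply hw').sub ((hDd.clm_apply hw').clm_apply hYd)
    have hη : ∀ {z : ℝ → E} {z' : E}, HasDerivAt z z' 0 → HasDerivAt
        (fun t => -(a x (z t) + (a (c t) (z t) + fderiv ℝ a (c t) (z t) (c t - x)))) _ 0 :=
      fun hz => (((hasDerivAt_const (0 : ℝ) (a x)).clm_apply hz).add
        ((had.clm_apply hz).add ((hDd.clm_apply hz).clm_apply hcx))).neg
    have h2 := ((hη hRd).mul (had.clm_apply hw')).sub (hη hw')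
    have h3 := h1.congr_of_eventuallyEq (f₁ := fun t =>
      -(a x (reebVector a (c t)) + (a (c t) (reebVector a (c t)) +
        fderiv ℝ a (c t) (reebVector a (c t)) (c t - x))) * a (c t) w -
      -(a x w + (a (c t) w + fderiv ℝ a (c t) w (c t - x)))) (by
      filter_upwards [hcU] with t ht
      have h4 := (ha.apply_contactVector ht (sinkHamiltonian a x (c t))
        (fderiv ℝ (sinkHamiltonian a x) (c t))).2 w
      rw [(ha.hasFDerivAt_sinkHamiltonian x ht).fderiv] at h4
      simp only [neg_apply, add_apply, ContinuousLinearMap.flip_apply] at h4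
      refine h4.symm.trans ?_
      simp only [hY, sinkField, contactField, Pi.sub_apply,
        (ha.hasFDerivAt_sinkHamiltonian x ht).fderiv])
    have h4 := h3.unique h2
    simp [hY0, hc0, hw, ha.apply_reebVector hx] at h4
    linarith
  have h0 : L - (-v - a x v • reebVector a x) = 0 := by
    refine ha.nondegenerate x hx _ ?_ fun w hw => ?_
    · simp only [map_sub, map_neg, map_smul, ha.apply_reebVector hx, e1, smul_eq_mul]
      ring
    · have h1 := e2 w hw
      have h2 := ha.fderiv_reebVector hx w
      simp only [map_sub, map_neg, map_smul, sub_apply, neg_apply, smul_apply, smul_eq_mul]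
      linear_combination h1 + a x v * h2
  exact sub_eq_zero.1 h0

theorem exists_contDiffBump_tsupport_subset {U : Set E} (hU : IsOpen U) {x : E} (hx : x ∈ U) :
    ∃ r > 0, ∀ δ, 0 < δ → δ < r → ∃ χ : E → ℝ, ContDiff ℝ ∞ χ ∧ HasCompactSupport χ ∧
      tsupport χ ⊆ U ∧ (∀ u ∈ Metric.ball x δ, χ u = 1) ∧ Metric.ball x δ ⊆ U := by
  obtain ⟨r, hr, hrU⟩ := Metric.nhds_basis_closedBall.mem_iff.1 (hU.mem_nhds hx)
  refine ⟨r, hr, fun δ hδ hδr => ?_⟩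
  let χ : ContDiffBump x := ⟨δ, r, hδ, hδr⟩
  refine ⟨χ, χ.contDiff, χ.hasCompactSupport, ?_, fun u hu => ?_, ?_⟩
  · rw [χ.tsupport_eq]
    exact hrU
  · exact χ.one_of_mem_closedBall (Metric.ball_subset_closedBall hu)
  · exact (Metric.ball_subset_closedBall.trans (Metric.closedBall_subset_closedBall hδr.le)).trans hrU

omit [FiniteDimensional ℝ E] in
/-- The Lyapunov estimate at the sink. -/
theorem lyapunov_estimate {b : E →L[ℝ] ℝ} {R : E} (hR : b R = 1) {w X : E}
    (hX : ‖X - (-w - b w • R)‖ ≤ 1 / (4 * (1 + ‖R‖ ^ 2 * ‖b‖ ^ 2)) * ‖w‖) :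
    2 * ⟪w, X⟫ + ‖R‖ ^ 2 * (2 * b w * b X) ≤ -(1 / 2) * ‖w‖ ^ 2 := by
  set e := X - (-w - b w • R) with he
  have hXe : X = -w - b w • R + e := by rw [he]; abel
  set A := 1 + ‖R‖ ^ 2 * ‖b‖ ^ 2 with hA
  have hA0 : 0 < A := by positivity
  have h1 : ⟪w, X⟫ = -‖w‖ ^ 2 - b w * ⟪w, R⟫ + ⟪w, e⟫ := by
    rw [hXe, inner_add_right, inner_sub_right, inner_neg_right, inner_smul_right,
      real_inner_self_eq_norm_sq]
  have h2 : b X = -b w - b w + b e := by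
    rw [hXe]
    simp [hR]
  have h3 : |⟪w, R⟫| ≤ ‖w‖ * ‖R‖ := abs_real_inner_le_norm w R
  have h4 : ⟪w, e⟫ ≤ ‖w‖ * ‖e‖ := real_inner_le_norm w e
  have h5 : -(2 * (b w * ⟪w, R⟫)) ≤ ‖w‖ ^ 2 + ‖R‖ ^ 2 * b w ^ 2 := by
    have h6 : -(b w * ⟪w, R⟫) ≤ |b w| * (‖w‖ * ‖R‖) := by
      refine (neg_le_abs _).trans ?_
      rw [abs_mul]
      exact mul_le_mul_of_nonneg_left h3 (abs_nonneg _)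
    have h7 := sq_nonneg (‖w‖ - ‖R‖ * |b w|)
    have h8 : |b w| ^ 2 = b w ^ 2 := sq_abs _
    nlinarith
  have h6 : b w * b e ≤ ‖b‖ ^ 2 * (‖w‖ * ‖e‖) := by
    calc b w * b e ≤ |b w * b e| := le_abs_self _
      _ = ‖b w‖ * ‖b e‖ := by rw [abs_mul]; rfl
      _ ≤ (‖b‖ * ‖w‖) * (‖b‖ * ‖e‖) :=
        mul_le_mul (b.le_opNorm w) (b.le_opNorm e) (norm_nonneg _) (by positivity)
      _ = _ := by ring
  have h7 : A * (‖w‖ * ‖e‖) ≤ 1 / 4 * ‖w‖ ^ 2 := by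
    have : A * (‖w‖ * ‖e‖) ≤ A * (‖w‖ * (1 / (4 * A) * ‖w‖)) := by gcongr
    refine this.trans (le_of_eq ?_)
    field_simp
  have h8 : ‖R‖ ^ 2 * (b w * b e) ≤ ‖R‖ ^ 2 * (‖b‖ ^ 2 * (‖w‖ * ‖e‖)) :=
    mul_le_mul_of_nonneg_left h6 (by positivity)
  have h9 : 0 ≤ ‖R‖ ^ 2 * b w ^ 2 := by positivity
  have h10 : A * (‖w‖ * ‖e‖) = ‖w‖ * ‖e‖ + ‖R‖ ^ 2 * (‖b‖ ^ 2 * (‖w‖ * ‖e‖)) := by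
    rw [hA]; ring
  rw [h1, h2]
  nlinarith

/-- Near any point a contact form admits compactly supported contact flows that squeeze a fixed ball
into arbitrarily small balls around any of its points. -/
theorem IsLocalContactForm.exists_squeezing {a : E → E →L[ℝ] ℝ} {U : Set E}
    (ha : IsLocalContactForm a U) {x : E} (hx : x ∈ U) :
    ∃ ρ > 0, Metric.ball x ρ ⊆ U ∧ ∀ p ∈ Metric.ball x ρ, ∀ ε > 0, ∃ X Φ, IsContactField a U X ∧
      IsFlow X Φ ∧ ContDiff ℝ ∞ (fun q : ℝ × E => Φ q.1 q.2) ∧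
      ∀ u ∈ Metric.ball x ρ, Φ 1 u ∈ Metric.ball p ε := by
  obtain ⟨r, hr, hbump⟩ := exists_contDiffBump_tsupport_subset ha.isOpen hx
  set R := reebVector a x with hRdef
  have hR : a x R = 1 := ha.apply_reebVector hx
  set A := 1 + ‖R‖ ^ 2 * ‖a x‖ ^ 2 with hA
  have hA1 : 1 ≤ A := by
    have : 0 ≤ ‖R‖ ^ 2 * ‖a x‖ ^ 2 := by positivity
    linarith
  have hA0 : 0 < A := by linarith
  have hstrict : HasStrictFDerivAt (sinkField a) (fderiv ℝ (sinkField a) (x, x)) (x, x) :=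
    (ha.contDiffAt_sinkField (q := (x, x)) hx hx).hasStrictFDerivAt (by simp)
  have hlin := hstrict.isLittleO.def (c := 1 / (4 * A)) (by positivity)
  obtain ⟨δ₀, hδ₀, hδ₀'⟩ := Metric.eventually_nhds_iff_ball.1 hlin
  set δ := min δ₀ (r / 2) with hδdef
  have hδ : 0 < δ := by positivity
  have hδr : δ < r := (min_le_right _ _).trans_lt (by linarith)
  obtain ⟨χ, hχ, hχc, hχU, hχ1, hballU⟩ := hbump δ hδ hδr
  have hest : ∀ p ∈ Metric.ball x δ, ∀ u ∈ Metric.ball x δ,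
      ‖sinkField a (p, u) - (-(u - p) - a x (u - p) • R)‖ ≤ 1 / (4 * A) * ‖u - p‖ := by
    intro p hp u hu
    have h1 := hδ₀' ((p, u), (p, p)) (by
      have hp' : dist p x < δ₀ := lt_of_lt_of_le hp (min_le_left _ _)
      have hu' : dist u x < δ₀ := lt_of_lt_of_le hu (min_le_left _ _)
      simp only [Metric.mem_ball, Prod.dist_eq, max_lt_iff]
      exact ⟨⟨hp', hu'⟩, hp', hp'⟩)
    simp only [ha.sinkField_self (hballU hp), Prod.mk_sub_mk, sub_self, sub_zero,
      ha.fderiv_sinkField hx, Prod.norm_mk, norm_zero, norm_nonneg, sup_of_le_right] at h1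
    exact h1
  set ρ := δ / (2 * A + 1) with hρdef
  have hρ : 0 < ρ := by positivity
  have hρδ : (2 * A + 1) * ρ = δ := by rw [hρdef]; field_simp
  have hρle : ρ ≤ δ := by nlinarith
  refine ⟨ρ, hρ, (Metric.ball_subset_ball hρle).trans hballU, fun p hp ε hε => ?_⟩
  have hpδ : p ∈ Metric.ball x δ := Metric.ball_subset_ball hρle hp
  have hpU : p ∈ U := hballU hpδ
  set H : E → ℝ := fun u => χ u * sinkHamiltonian a p u with hH
  have hHsupp : tsupport H ⊆ tsupport χ := tsupport_mul_subset_left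
  have hHsm : ContDiff ℝ ∞ H := by
    refine contDiff_iff_contDiffAt.2 fun u => ?_
    by_cases hu : u ∈ U
    · refine hχ.contDiffAt.mul ?_
      exact (ha.contDiffAt_sinkHamiltonian hpU hu).comp u (contDiffAt_const.prodMk contDiffAt_id)
    · have h1 : (tsupport χ)ᶜ ∈ 𝓝 u :=
        (isClosed_tsupport χ).isOpen_compl.mem_nhds fun h => hu (hχU h)
      refine (contDiffAt_const (c := (0 : ℝ))).congr_of_eventuallyEq ?_
      filter_upwards [h1] with w hw
      simp [hH, image_eq_zero_of_notMem_tsupport hw]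
  have hX : IsContactField a U (contactField a H) :=
    ha.isContactField hHsm (hχc.mono' ((subset_tsupport _).trans hHsupp)) (hHsupp.trans hχU)
  have hXeq : ∀ u ∈ Metric.ball x δ, contactField a H u = sinkField a (p, u) := by
    intro u hu
    have h1 : H =ᶠ[𝓝 u] sinkHamiltonian a p := by
      filter_upwards [Metric.isOpen_ball.mem_nhds hu] with w hw
      simp [hH, hχ1 w hw]
    simp only [contactField, sinkField, h1.fderiv_eq, h1.eq_of_nhds]
  obtain ⟨Φ, hΦ, hΦsm⟩ := exists_smooth_isFlow hX.contDiff hX.hasCompactSupport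
  set Q : E → ℝ := fun w => ‖w‖ ^ 2 + ‖R‖ ^ 2 * (a x w) ^ 2 with hQ
  have hQle : ∀ w, Q w ≤ A * ‖w‖ ^ 2 := by
    intro w
    have h1 : (a x w) ^ 2 ≤ (‖a x‖ * ‖w‖) ^ 2 := by
      rw [← sq_abs]
      exact pow_le_pow_left₀ (abs_nonneg _) ((a x).le_opNorm w) 2
    have h2 := mul_le_mul_of_nonneg_left h1 (sq_nonneg ‖R‖)
    simp only [hQ, hA]
    nlinarith
  have hQge : ∀ w, ‖w‖ ^ 2 ≤ Q w := fun w => le_add_of_nonneg_right (by positivity)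
  set κ := 1 / (4 * A) with hκ
  have hκ0 : 0 < κ := by positivity
  set M := 4 * A * ρ ^ 2 with hM
  have hM0 : 0 < M := by positivity
  have hdecay : ∀ u ∈ Metric.ball x ρ, ∀ T, 0 ≤ T → Q (Φ T u - p) ≤ M * Real.exp (-(κ * T)) := by
    intro u hu T hT
    have hqd : ∀ t, HasDerivAt (fun t => Q (Φ t u - p))
        (2 * ⟪Φ t u - p, contactField a H (Φ t u)⟫ +
          ‖R‖ ^ 2 * (2 * a x (Φ t u - p) * a x (contactField a H (Φ t u)))) t := by
      intro t
      have h1 : HasDerivAt (fun t => Φ t u - p) (contactField a H (Φ t u)) t :=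
        (hΦ.hasDerivAt t u).sub_const p
      have h2 := h1.norm_sq
      have h3 : HasDerivAt (fun t => a x (Φ t u - p)) (a x (contactField a H (Φ t u))) t :=
        (a x).hasFDerivAt.comp_hasDerivAt t h1
      have h4 := (h3.pow 2).const_mul (‖R‖ ^ 2)
      refine (h2.add h4).congr_deriv ?_
      simp
    have hBd : ∀ t, HasDerivAt (fun t => M * Real.exp (-(κ * t)))
        (-κ * (M * Real.exp (-(κ * t)))) t := by
      intro t
      have := ((((hasDerivAt_id t).const_mul κ).neg).exp).const_mul M
      refine this.congr_deriv ?_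
      simp
      ring
    refine image_le_of_deriv_right_lt_deriv_boundary (a := 0) (b := T)
      (fun t _ => (hqd t).continuousAt.continuousWithinAt) (fun t _ => (hqd t).hasDerivWithinAt) ?_
      hBd (fun t ht heq => ?_) ⟨hT, le_rfl⟩
    · rw [hΦ.zero, mul_zero, neg_zero, Real.exp_zero, mul_one]
      refine (hQle _).trans ?_
      have h1 : ‖u - p‖ ≤ 2 * ρ := by
        rw [← dist_eq_norm]
        have := dist_triangle_right u p x
        rw [Metric.mem_ball] at hu hp
        linarith
      have h2 := pow_le_pow_left₀ (norm_nonneg _) h1 2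
      rw [hM]
      nlinarith
    · have hB0 : 0 < M * Real.exp (-(κ * t)) := by positivity
      have hBM : M * Real.exp (-(κ * t)) ≤ M := by
        refine mul_le_of_le_one_right hM0.le (Real.exp_le_one_iff.2 ?_)
        have := mul_nonneg hκ0.le ht.1
        linarith
      have h1 : ‖Φ t u - p‖ ≤ 2 * A * ρ := by
        have h2 : ‖Φ t u - p‖ ^ 2 ≤ (2 * A * ρ) ^ 2 := by
          refine (hQge _).trans ((heq.le.trans hBM).trans ?_)
          have h3 : A ≤ A ^ 2 := by nlinarith
          have h4 := mul_le_mul_of_nonneg_right h3 (sq_nonneg ρ)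
          rw [hM]
          nlinarith
        exact (pow_le_pow_iff_left₀ (norm_nonneg _) (by positivity) two_ne_zero).1 h2
      have h2 : Φ t u ∈ Metric.ball x δ := by
        rw [Metric.mem_ball] at hp ⊢
        have h3 := dist_triangle (Φ t u) p x
        rw [dist_eq_norm (Φ t u) p] at h3
        nlinarith
      have h3 := hest p hpδ _ h2
      rw [← hXeq _ h2] at h3
      have h4 := lyapunov_estimate hR h3
      have h5 := hQle (Φ t u - p)
      have h6 : κ * Q (Φ t u - p) ≤ 1 / 4 * ‖Φ t u - p‖ ^ 2 := by
        refine (mul_le_mul_of_nonneg_left h5 hκ0.le).trans (le_of_eq ?_)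
        rw [hκ]
        field_simp
      rw [← heq] at hB0 ⊢
      nlinarith
  obtain ⟨T, hT0, hT⟩ : ∃ T, 0 < T ∧ M * Real.exp (-(κ * T)) < ε ^ 2 := by
    have h1 : Filter.Tendsto (fun T : ℝ => M * Real.exp (-(κ * T))) Filter.atTop (𝓝 (M * 0)) :=
      ((Real.tendsto_exp_neg_atTop_nhds_zero).comp
        (Filter.tendsto_id.const_mul_atTop hκ0)).const_mul M
    rw [mul_zero] at h1
    exact ((Filter.eventually_gt_atTop 0).and (h1.eventually_lt_const (by positivity))).exists
  refine ⟨T • contactField a H, fun t => Φ (T * t), hX.smul T, hΦ.smul T,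
    hΦsm.comp ((contDiff_const.mul contDiff_fst).prodMk contDiff_snd), fun u hu => ?_⟩
  rw [Metric.mem_ball, dist_eq_norm]
  simp only [mul_one]
  have h1 := ((hQge _).trans (hdecay u hu T hT0.le)).trans_lt hT
  exact lt_of_pow_lt_pow_left₀ 2 hε.le h1

/-- Every non-empty open set supports a non-trivial contact flow. -/
theorem IsLocalContactForm.exists_ne_id {a : E → E →L[ℝ] ℝ} {U V : Set E}
    (ha : IsLocalContactForm a U) (hV : IsOpen V) (hVU : V ⊆ U) (hVne : V.Nonempty) :
    ∃ X Φ, IsContactField a U X ∧ tsupport X ⊆ V ∧ IsFlow X Φ ∧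
      ContDiff ℝ ∞ (fun q : ℝ × E => Φ q.1 q.2) ∧ ∃ u, Φ 1 u ≠ u := by
  obtain ⟨x, hx⟩ := hVne
  obtain ⟨r, hr, hbump⟩ := exists_contDiffBump_tsupport_subset hV hx
  obtain ⟨χ, hχ, hχc, hχV, hχ1, -⟩ := hbump (r / 2) (by positivity) (by linarith)
  have hX := ha.isContactField hχ hχc (hχV.trans hVU)
  obtain ⟨Φ, hΦ, hΦsm⟩ := exists_smooth_isFlow hX.contDiff hX.hasCompactSupport
  have hX0 : contactField a χ x ≠ 0 := by
    intro h
    have h1 := (ha.apply_contactVector (hVU hx) (χ x) (fderiv ℝ χ x)).1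
    change a x (contactField a χ x) = χ x at h1
    rw [h, map_zero, hχ1 x (Metric.mem_ball_self (by positivity))] at h1
    exact zero_ne_one h1
  obtain ⟨t, ht⟩ : ∃ t, Φ t x ≠ x := by
    by_contra! hcon
    have h1 := hΦ.hasDerivAt 0 x
    simp only [hcon] at h1
    exact hX0 (h1.unique (hasDerivAt_const 0 x))
  refine ⟨t • contactField a χ, fun s => Φ (t * s), hX.smul t, ?_, hΦ.smul t,
    hΦsm.comp ((contDiff_const.mul contDiff_fst).prodMk contDiff_snd), x, by simpa using ht⟩
  exact (tsupport_smul_subset_right (fun _ => t) _).trans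
    ((tsupport_contactField_subset a χ).trans hχV)

end Squeezing

section Chart

open scoped Topology

variable {d : ℕ} {M : Type*} [TopologicalSpace M] [ChartedSpace (EuclideanSpace ℝ (Fin d)) M]

/-- The pullback of a 1-form by the inverse of the preferred chart around `x₀`. -/
def CovectorField.chartForm (α : CovectorField d M) (x₀ : M) (u : EuclideanSpace ℝ (Fin d)) :
    EuclideanSpace ℝ (Fin d) →L[ℝ] ℝ :=
  (α ((extChartAt (𝓡 d) x₀).symm u)).comp
    (mfderiv 𝓘(ℝ, EuclideanSpace ℝ (Fin d)) (𝓡 d) (extChartAt (𝓡 d) x₀).symm u)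

theorem CovectorField.inChart_eq (α : CovectorField d M) (x₀ : M)
    (u : EuclideanSpace ℝ (Fin d)) :
    α.inChart x₀ u = ContinuousAlternatingMap.ofSubsingletonLIE (𝕜 := ℝ) (0 : Fin 1)
      (α.chartForm x₀ u) := rfl

variable [IsManifold (𝓡 d) ∞ M]

theorem CovectorField.IsSmooth.contDiffOn_chartForm {α : CovectorField d M} (hα : α.IsSmooth) (x₀ : M) :
    ContDiffOn ℝ ∞ (α.chartForm x₀) (extChartAt (𝓡 d) x₀).target := by
  rw [contDiffOn_clm_apply]
  intro w
  set e := extChartAt (𝓡 d) x₀ with he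
  have hopen : IsOpen e.target := isOpen_extChartAt_target x₀
  have hsymm : ContMDiffOn 𝓘(ℝ, EuclideanSpace ℝ (Fin d)) (𝓡 d) ∞ e.symm e.target :=
    contMDiffOn_extChartAt_symm x₀
  have h1 := hsymm.contMDiffOn_tangentMapWithin (m := ∞) (by simp) hopen.uniqueMDiffOn
  have h2 : ContMDiff 𝓘(ℝ, EuclideanSpace ℝ (Fin d)) 𝓘(ℝ, EuclideanSpace ℝ (Fin d)).tangent ∞
      (fun u => (⟨u, w⟩ : TangentBundle 𝓘(ℝ, EuclideanSpace ℝ (Fin d))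
        (EuclideanSpace ℝ (Fin d)))) :=
    contMDiff_vectorSpace_iff_contDiff.2 contDiff_const
  have h3 : ContMDiffOn 𝓘(ℝ, EuclideanSpace ℝ (Fin d)) (𝓡 d).tangent ∞
      (fun u => (⟨e.symm u, mfderiv 𝓘(ℝ, EuclideanSpace ℝ (Fin d)) (𝓡 d) e.symm u w⟩ :
        TangentBundle (𝓡 d) M)) e.target := by
    refine (h1.comp h2.contMDiffOn (fun u hu => hu)).congr fun u hu => ?_
    simp only [Function.comp_apply, tangentMapWithin, mfderivWithin_of_isOpen hopen hu]
  intro u hu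
  have h4 := (h3 u hu).contMDiffAt (hopen.mem_nhds hu)
  have h5 : ContMDiffAt 𝓘(ℝ, EuclideanSpace ℝ (Fin d))
      ((𝓡 d).prod 𝓘(ℝ, EuclideanSpace ℝ (Fin d) →L[ℝ] ℝ)) ∞
      (fun u => Bundle.TotalSpace.mk' (EuclideanSpace ℝ (Fin d) →L[ℝ] ℝ)
      (E := fun x : M => TangentSpace (𝓡 d) x →L[ℝ] Bundle.Trivial M ℝ x) (e.symm u)
        (α (e.symm u))) u :=
    (hα.contMDiffAt (x := e.symm u)).comp u ((hsymm u hu).contMDiffAt (hopen.mem_nhds hu))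
  have h6 := ContMDiffAt.clm_bundle_apply (F₂ := ℝ) (E₂ := Bundle.Trivial M ℝ) h5 h4
  have h7 := (Bundle.contMDiffAt_totalSpace.1 h6).2
  exact (contMDiffAt_iff_contDiffAt.1 h7).contDiffWithinAt

theorem differentiableAt_ofSubsingleton {E : Type*} [NormedAddCommGroup E] [NormedSpace ℝ E]
    {a : E → E →L[ℝ] ℝ} {u : E} (ha : DifferentiableAt ℝ a u) : DifferentiableAt ℝ
      (fun u => ContinuousAlternatingMap.ofSubsingletonLIE (𝕜 := ℝ) (0 : Fin 1) (a u)) u :=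
  (ContinuousAlternatingMap.ofSubsingletonLIE (𝕜 := ℝ) (E := E) (F := ℝ)
    (0 : Fin 1)).differentiable.differentiableAt.comp u ha

/-- The exterior derivative of a 1-form on a vector space. -/
theorem extDeriv_ofSubsingleton {E : Type*} [NormedAddCommGroup E] [NormedSpace ℝ E]
    {a : E → E →L[ℝ] ℝ} {u : E} (ha : DifferentiableAt ℝ a u) (v w : E) :
    extDeriv (fun u => ContinuousAlternatingMap.ofSubsingletonLIE (𝕜 := ℝ) (0 : Fin 1) (a u)) u ![v, w] =
      fderiv ℝ a u v w - fderiv ℝ a u w v := by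
  have hd := differentiableAt_ofSubsingleton ha
  have h1 : ∀ z : E, HasFDerivAt (fun u => a u z) ((fderiv ℝ a u).flip z) u := by
    intro z
    have := ha.hasFDerivAt.clm_apply (hasFDerivAt_const z u)
    simpa using this
  rw [extDeriv_apply hd, Fin.sum_univ_two]
  have h2 : ∀ i : Fin 2, (fun u => (ContinuousAlternatingMap.ofSubsingletonLIE (𝕜 := ℝ) (0 : Fin 1) (a u) :
      E [⋀^Fin 1]→L[ℝ] ℝ) (i.removeNth ![v, w])) = fun u => a u ((i.removeNth ![v, w]) 0) :=
    fun i => rfl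
  rw [h2, h2, (h1 _).fderiv, (h1 _).fderiv]
  simp [Fin.removeNth, sub_eq_add_neg]

/-- The coordinate change between two preferred charts. -/
def chartChange (x₀ x₁ : M) (u : EuclideanSpace ℝ (Fin d)) : EuclideanSpace ℝ (Fin d) :=
  extChartAt (𝓡 d) x₁ ((extChartAt (𝓡 d) x₀).symm u)

theorem mdifferentiableAt_extChartAt_symm {x₀ : M} {u : EuclideanSpace ℝ (Fin d)}
    (hu : u ∈ (extChartAt (𝓡 d) x₀).target) :
    MDifferentiableAt 𝓘(ℝ, EuclideanSpace ℝ (Fin d)) (𝓡 d) (extChartAt (𝓡 d) x₀).symm u :=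
  ((contMDiffOn_extChartAt_symm (n := ∞) x₀ u hu).contMDiffAt
    ((isOpen_extChartAt_target x₀).mem_nhds hu)).mdifferentiableAt (by simp)

theorem contMDiffAt_extChartAt_of_mem {x₁ y : M} (hy : y ∈ (extChartAt (𝓡 d) x₁).source) :
    ContMDiffAt (𝓡 d) 𝓘(ℝ, EuclideanSpace ℝ (Fin d)) ∞ (extChartAt (𝓡 d) x₁) y :=
  contMDiffAt_extChartAt' (by rwa [extChartAt_source] at hy)

theorem contDiffAt_chartChange {x₀ x₁ : M} {u : EuclideanSpace ℝ (Fin d)}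
    (hu : u ∈ (extChartAt (𝓡 d) x₀).target)
    (hu' : (extChartAt (𝓡 d) x₀).symm u ∈ (extChartAt (𝓡 d) x₁).source) :
    ContDiffAt ℝ ∞ (chartChange x₀ x₁) u := by
  refine contMDiffAt_iff_contDiffAt.1 ?_
  exact (contMDiffAt_extChartAt_of_mem hu').comp u
    ((contMDiffOn_extChartAt_symm (n := ∞) x₀ u hu).contMDiffAt
      ((isOpen_extChartAt_target x₀).mem_nhds hu))

theorem hasFDerivAt_chartChange {x₀ x₁ : M} {u : EuclideanSpace ℝ (Fin d)}
    (hu : u ∈ (extChartAt (𝓡 d) x₀).target)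
    (hu' : (extChartAt (𝓡 d) x₀).symm u ∈ (extChartAt (𝓡 d) x₁).source)
    (v : EuclideanSpace ℝ (Fin d)) :
    fderiv ℝ (chartChange x₀ x₁) u v =
      mfderiv (𝓡 d) 𝓘(ℝ, EuclideanSpace ℝ (Fin d)) (extChartAt (𝓡 d) x₁)
        ((extChartAt (𝓡 d) x₀).symm u)
        (mfderiv 𝓘(ℝ, EuclideanSpace ℝ (Fin d)) (𝓡 d) (extChartAt (𝓡 d) x₀).symm u v) := by
  have h := mfderiv_comp u ((contMDiffAt_extChartAt_of_mem hu').mdifferentiableAt (by simp))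
    (mdifferentiableAt_extChartAt_symm hu)
  rw [← mfderiv_eq_fderiv]
  exact congrArg (fun A => A v) h

theorem CovectorField.chartForm_eq_pullback (α : CovectorField d M) {x₀ x₁ : M}
    {u : EuclideanSpace ℝ (Fin d)} (hu : u ∈ (extChartAt (𝓡 d) x₀).target)
    (hu' : (extChartAt (𝓡 d) x₀).symm u ∈ (extChartAt (𝓡 d) x₁).source) :
    α.chartForm x₀ u = (α.chartForm x₁ (chartChange x₀ x₁ u)).comp (fderiv ℝ (chartChange x₀ x₁) u) := by
  have hmem : chartChange x₀ x₁ u ∈ (extChartAt (𝓡 d) x₁).target :=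
    (extChartAt (𝓡 d) x₁).map_source hu'
  have h1 : HasMFDerivAt 𝓘(ℝ, EuclideanSpace ℝ (Fin d)) (𝓡 d)
      ((extChartAt (𝓡 d) x₁).symm ∘ chartChange x₀ x₁) u
      ((mfderiv 𝓘(ℝ, EuclideanSpace ℝ (Fin d)) (𝓡 d) (extChartAt (𝓡 d) x₁).symm
        (chartChange x₀ x₁ u)).comp (fderiv ℝ (chartChange x₀ x₁) u)) :=
    (mdifferentiableAt_extChartAt_symm hmem).hasMFDerivAt.comp u
      ((contDiffAt_chartChange hu hu').differentiableAt (by simp)).hasFDerivAt.hasMFDerivAt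
  have h2 : (extChartAt (𝓡 d) x₀).symm =ᶠ[𝓝 u]
      (extChartAt (𝓡 d) x₁).symm ∘ chartChange x₀ x₁ := by
    filter_upwards [(continuousAt_extChartAt_symm'' hu).preimage_mem_nhds
      ((isOpen_extChartAt_source x₁).mem_nhds hu')] with z hz
    exact ((extChartAt (𝓡 d) x₁).left_inv hz).symm
  have h3 := (h1.congr_of_eventuallyEq h2).mfderiv
  have h4 : (extChartAt (𝓡 d) x₀).symm u = (extChartAt (𝓡 d) x₁).symm (chartChange x₀ x₁ u) :=
    h2.eq_of_nhds
  have key : ∀ (y y' : M) (_ : y = y') (A B : EuclideanSpace ℝ (Fin d) →L[ℝ] EuclideanSpace ℝ (Fin d))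
      (_ : A = B), (show EuclideanSpace ℝ (Fin d) →L[ℝ] ℝ from α y).comp A =
        (show EuclideanSpace ℝ (Fin d) →L[ℝ] ℝ from α y').comp B := by
    rintro y _ rfl A _ rfl
    rfl
  exact key _ _ h4 _ _ h3

theorem CovectorField.d_eq {α : CovectorField d M} (hα : α.IsSmooth) (x₀ : M)
    {u : EuclideanSpace ℝ (Fin d)} (hu : u ∈ (extChartAt (𝓡 d) x₀).target)
    (v w : EuclideanSpace ℝ (Fin d)) :
    fderiv ℝ (α.chartForm x₀) u v w - fderiv ℝ (α.chartForm x₀) u w v =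
      α.d ((extChartAt (𝓡 d) x₀).symm u)
        (mfderiv 𝓘(ℝ, EuclideanSpace ℝ (Fin d)) (𝓡 d) (extChartAt (𝓡 d) x₀).symm u v)
        (mfderiv 𝓘(ℝ, EuclideanSpace ℝ (Fin d)) (𝓡 d) (extChartAt (𝓡 d) x₀).symm u w) := by
  set x₁ := (extChartAt (𝓡 d) x₀).symm u with hx₁
  have hu' : (extChartAt (𝓡 d) x₀).symm u ∈ (extChartAt (𝓡 d) x₁).source :=
    mem_extChartAt_source x₁
  have hmem : chartChange x₀ x₁ u ∈ (extChartAt (𝓡 d) x₁).target :=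
    (extChartAt (𝓡 d) x₁).map_source hu'
  have hd : ∀ (x : M) (z) (_ : z ∈ (extChartAt (𝓡 d) x).target),
      DifferentiableAt ℝ (α.chartForm x) z := fun x z hz =>
    ((hα.contDiffOn_chartForm x).contDiffAt
      ((isOpen_extChartAt_target x).mem_nhds hz)).differentiableAt (by simp)
  have hd' : DifferentiableAt ℝ (α.inChart x₁) (chartChange x₀ x₁ u) :=
    differentiableAt_ofSubsingleton (hd x₁ _ hmem)
  have h1 : α.inChart x₀ =ᶠ[𝓝 u] fun z => (α.inChart x₁
      (chartChange x₀ x₁ z)).compContinuousLinearMap (fderiv ℝ (chartChange x₀ x₁) z) := by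
    filter_upwards [(continuousAt_extChartAt_symm'' hu).preimage_mem_nhds
      ((isOpen_extChartAt_source x₁).mem_nhds hu'),
      (isOpen_extChartAt_target x₀).mem_nhds hu] with z hz hz'
    rw [α.inChart_eq, α.inChart_eq, α.chartForm_eq_pullback hz' hz]
    rfl
  have h2 := h1.extDeriv_eq
  rw [extDeriv_pullback (r := ∞) hd' (contDiffAt_chartChange hu hu') (by
    rw [minSmoothness_of_isRCLikeNormedField]
    exact WithTop.coe_le_coe.2 (le_top (a := (2 : ℕ∞))))] at h2
  have h3 := congrArg (fun η => η ![v, w]) h2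
  have h4 : extDeriv (α.inChart x₀) u ![v, w] =
      fderiv ℝ (α.chartForm x₀) u v w - fderiv ℝ (α.chartForm x₀) u w v :=
    extDeriv_ofSubsingleton (hd x₀ u hu) v w
  rw [← h4]
  refine h3.trans ?_
  rw [ContinuousAlternatingMap.compContinuousLinearMap_apply, CovectorField.d]
  have h5 : (⇑(fderiv ℝ (chartChange x₀ x₁) u) ∘ ![v, w]) =
      ![fderiv ℝ (chartChange x₀ x₁) u v, fderiv ℝ (chartChange x₀ x₁) u w] := by
    ext i : 1
    fin_cases i <;> rfl
  rw [h5, hasFDerivAt_chartChange hu hu', hasFDerivAt_chartChange hu hu']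
  rfl

theorem bijective_mfderiv_extChartAt_symm {x₀ : M} {u : EuclideanSpace ℝ (Fin d)}
    (hu : u ∈ (extChartAt (𝓡 d) x₀).target) : Function.Bijective
      (mfderiv 𝓘(ℝ, EuclideanSpace ℝ (Fin d)) (𝓡 d) (extChartAt (𝓡 d) x₀).symm u) := by
  have : IsManifold (𝓡 d) 1 M := IsManifold.of_le (n := ∞) (by simp)
  have h := isInvertible_mfderivWithin_extChartAt_symm (I := 𝓡 d) hu
  rw [ModelWithCorners.range_eq_univ, mfderivWithin_univ] at h
  exact h.bijective

theorem isLocalContactForm_chartForm {n : ℕ} {M : Type*} [TopologicalSpace M]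
    [ChartedSpace (EuclideanSpace ℝ (Fin (2 * n + 1))) M] [IsManifold (𝓡 (2 * n + 1)) ∞ M]
    {α : CovectorField (2 * n + 1) M} (hα : IsContactForm α) (x₀ : M) :
    IsLocalContactForm (α.chartForm x₀) (extChartAt (𝓡 (2 * n + 1)) x₀).target where
  isOpen := isOpen_extChartAt_target x₀
  contDiffOn := hα.smooth.contDiffOn_chartForm x₀
  ne_zero u hu h := by
    refine hα.ne_zero ((extChartAt (𝓡 (2 * n + 1)) x₀).symm u) ?_
    ext v
    obtain ⟨v', rfl⟩ := (bijective_mfderiv_extChartAt_symm hu).surjective v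
    exact congrArg (fun A => A v') h
  nondegenerate u hu v hv h := by
    have h1 := hα.nondegenerate ((extChartAt (𝓡 (2 * n + 1)) x₀).symm u)
      (mfderiv 𝓘(ℝ, EuclideanSpace ℝ (Fin (2 * n + 1))) (𝓡 (2 * n + 1))
        (extChartAt (𝓡 (2 * n + 1)) x₀).symm u v) hv fun w hw => by
      obtain ⟨w', rfl⟩ := (bijective_mfderiv_extChartAt_symm hu).surjective w
      rw [← h w' hw]
      exact (CovectorField.d_eq hα.smooth x₀ hu v w').symm
    exact (bijective_mfderiv_extChartAt_symm hu).injective (h1.trans (map_zero _).symm)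

end Chart

section Transport

open scoped Topology

variable {d : ℕ} {M : Type*} [TopologicalSpace M] [ChartedSpace (EuclideanSpace ℝ (Fin d)) M]

open Classical in
/-- A map of the chart domain, extended by the identity to the manifold. -/
def chartExtend (x₀ : M) (f : EuclideanSpace ℝ (Fin d) → EuclideanSpace ℝ (Fin d)) (y : M) : M :=
  if y ∈ (extChartAt (𝓡 d) x₀).source then
    (extChartAt (𝓡 d) x₀).symm (f (extChartAt (𝓡 d) x₀ y)) else y

theorem chartExtend_of_mem {x₀ : M} (f : EuclideanSpace ℝ (Fin d) → EuclideanSpace ℝ (Fin d)) {y : M}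
    (hy : y ∈ (extChartAt (𝓡 d) x₀).source) :
    chartExtend x₀ f y = (extChartAt (𝓡 d) x₀).symm (f (extChartAt (𝓡 d) x₀ y)) := if_pos hy

theorem chartExtend_of_notMem {x₀ : M} (f : EuclideanSpace ℝ (Fin d) → EuclideanSpace ℝ (Fin d))
    {y : M} (hy : y ∉ (extChartAt (𝓡 d) x₀).source) : chartExtend x₀ f y = y := if_neg hy

theorem chartExtend_comp {x₀ : M} {f g : EuclideanSpace ℝ (Fin d) → EuclideanSpace ℝ (Fin d)}
    (hg : MapsTo g (extChartAt (𝓡 d) x₀).target (extChartAt (𝓡 d) x₀).target)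
    (hfg : ∀ u, f (g u) = u) (y : M) : chartExtend x₀ f (chartExtend x₀ g y) = y := by
  by_cases hy : y ∈ (extChartAt (𝓡 d) x₀).source
  · have h1 := hg ((extChartAt (𝓡 d) x₀).map_source hy)
    rw [chartExtend_of_mem g hy, chartExtend_of_mem f ((extChartAt (𝓡 d) x₀).map_target h1),
      (extChartAt (𝓡 d) x₀).right_inv h1, hfg, (extChartAt (𝓡 d) x₀).left_inv hy]
  · rw [chartExtend_of_notMem g hy, chartExtend_of_notMem f hy]

/-- The flow of a vector field supported in a chart domain, as a family of permutations of the
manifold. -/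
def chartFlow (x₀ : M) {X : EuclideanSpace ℝ (Fin d) → EuclideanSpace ℝ (Fin d)}
    {Φ : ℝ → EuclideanSpace ℝ (Fin d) → EuclideanSpace ℝ (Fin d)} (hΦ : IsFlow X Φ)
    (hmaps : ∀ t, MapsTo (Φ t) (extChartAt (𝓡 d) x₀).target (extChartAt (𝓡 d) x₀).target) (t : ℝ) :
    Equiv.Perm M where
  toFun := chartExtend x₀ (Φ t)
  invFun := chartExtend x₀ (Φ (-t))
  left_inv := chartExtend_comp (hmaps t) (hΦ.neg_apply t)
  right_inv := chartExtend_comp (hmaps (-t)) (hΦ.apply_neg t)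

theorem chartExtend_eq_self {x₀ : M} {f : EuclideanSpace ℝ (Fin d) → EuclideanSpace ℝ (Fin d)}
    {S : Set (EuclideanSpace ℝ (Fin d))} (hf : ∀ u ∉ S, f u = u) {y : M}
    (hy : y ∉ (extChartAt (𝓡 d) x₀).symm '' S) : chartExtend x₀ f y = y := by
  by_cases h : y ∈ (extChartAt (𝓡 d) x₀).source
  · rw [chartExtend_of_mem f h, hf, (extChartAt (𝓡 d) x₀).left_inv h]
    exact fun h' => hy ⟨_, h', (extChartAt (𝓡 d) x₀).left_inv h⟩
  · exact chartExtend_of_notMem f h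

theorem isCompact_extChartAt_symm_image {x₀ : M} {S : Set (EuclideanSpace ℝ (Fin d))}
    (hS : IsCompact S) (hSU : S ⊆ (extChartAt (𝓡 d) x₀).target) :
    IsCompact ((extChartAt (𝓡 d) x₀).symm '' S) :=
  hS.image_of_continuousOn ((continuousOn_extChartAt_symm x₀).mono hSU)

variable [IsManifold (𝓡 d) ∞ M]

theorem contMDiff_chartExtend [T2Space M] {x₀ : M}
    {Φ : ℝ → EuclideanSpace ℝ (Fin d) → EuclideanSpace ℝ (Fin d)}
    (hsm : ContDiff ℝ ∞ (fun q : ℝ × EuclideanSpace ℝ (Fin d) => Φ q.1 q.2))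
    (hmaps : ∀ t, MapsTo (Φ t) (extChartAt (𝓡 d) x₀).target (extChartAt (𝓡 d) x₀).target)
    {S : Set (EuclideanSpace ℝ (Fin d))} (hS : IsCompact S)
    (hSU : S ⊆ (extChartAt (𝓡 d) x₀).target) (hfix : ∀ t, ∀ u ∉ S, Φ t u = u) :
    ContMDiff (𝓘(ℝ, ℝ).prod (𝓡 d)) (𝓡 d) ∞ (fun p : ℝ × M => chartExtend x₀ (Φ p.1) p.2) := by
  rintro ⟨t, y⟩
  by_cases hy : y ∈ (extChartAt (𝓡 d) x₀).source
  · have hmem := hmaps t ((extChartAt (𝓡 d) x₀).map_source hy)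
    have h1 : ContMDiffAt (𝓘(ℝ, ℝ).prod (𝓡 d)) 𝓘(ℝ, EuclideanSpace ℝ (Fin d)) ∞
        (fun p : ℝ × M => extChartAt (𝓡 d) x₀ p.2) (t, y) :=
      ContMDiffAt.comp (t, y) (contMDiffAt_extChartAt_of_mem hy) contMDiffAt_snd
    have h2 : ContMDiffAt (𝓘(ℝ, ℝ).prod (𝓡 d)) 𝓘(ℝ, ℝ × EuclideanSpace ℝ (Fin d)) ∞
        (fun p : ℝ × M => (p.1, extChartAt (𝓡 d) x₀ p.2)) (t, y) :=
      contMDiffAt_fst.prodMk_space h1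
    have h3 : ContMDiffAt (𝓘(ℝ, ℝ).prod (𝓡 d)) 𝓘(ℝ, EuclideanSpace ℝ (Fin d)) ∞
        (fun p : ℝ × M => Φ p.1 (extChartAt (𝓡 d) x₀ p.2)) (t, y) :=
      ContMDiffAt.comp (t, y) (hsm.contMDiff (t, extChartAt (𝓡 d) x₀ y)) h2
    have h4 : ContMDiffAt 𝓘(ℝ, EuclideanSpace ℝ (Fin d)) (𝓡 d) ∞ (extChartAt (𝓡 d) x₀).symm
        (Φ t (extChartAt (𝓡 d) x₀ y)) :=
      (contMDiffOn_extChartAt_symm x₀ _ hmem).contMDiffAt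
        ((isOpen_extChartAt_target x₀).mem_nhds hmem)
    refine (ContMDiffAt.comp (t, y) h4 h3).congr_of_eventuallyEq ?_
    filter_upwards [continuousAt_snd.preimage_mem_nhds
      ((isOpen_extChartAt_source x₀).mem_nhds hy)] with p hp
    exact chartExtend_of_mem _ hp
  · refine contMDiffAt_snd.congr_of_eventuallyEq ?_
    have hy' : y ∉ (extChartAt (𝓡 d) x₀).symm '' S := by
      rintro ⟨u, hu, rfl⟩
      exact hy ((extChartAt (𝓡 d) x₀).map_target (hSU hu))
    filter_upwards [continuousAt_snd.preimage_mem_nhds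
      ((isCompact_extChartAt_symm_image hS hSU).isClosed.isOpen_compl.mem_nhds hy')] with p hp
    exact chartExtend_eq_self (hfix p.1) hp

theorem mfderiv_chartExtend {x₀ : M} {f : EuclideanSpace ℝ (Fin d) → EuclideanSpace ℝ (Fin d)}
    (hf : Differentiable ℝ f)
    (hmaps : MapsTo f (extChartAt (𝓡 d) x₀).target (extChartAt (𝓡 d) x₀).target)
    {u : EuclideanSpace ℝ (Fin d)} (hu : u ∈ (extChartAt (𝓡 d) x₀).target)
    (hsm : MDifferentiableAt (𝓡 d) (𝓡 d) (chartExtend x₀ f) ((extChartAt (𝓡 d) x₀).symm u))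
    (v : EuclideanSpace ℝ (Fin d)) :
    mfderiv (𝓡 d) (𝓡 d) (chartExtend x₀ f) ((extChartAt (𝓡 d) x₀).symm u)
      (mfderiv 𝓘(ℝ, EuclideanSpace ℝ (Fin d)) (𝓡 d) (extChartAt (𝓡 d) x₀).symm u v) =
    mfderiv 𝓘(ℝ, EuclideanSpace ℝ (Fin d)) (𝓡 d) (extChartAt (𝓡 d) x₀).symm (f u)
      (fderiv ℝ f u v) := by
  have h1 := hsm.hasMFDerivAt.comp u (mdifferentiableAt_extChartAt_symm hu).hasMFDerivAt
  have h2 := (mdifferentiableAt_extChartAt_symm (hmaps hu)).hasMFDerivAt.comp u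
    (hf u).hasFDerivAt.hasMFDerivAt
  have h3 : chartExtend x₀ f ∘ (extChartAt (𝓡 d) x₀).symm =ᶠ[𝓝 u]
      (extChartAt (𝓡 d) x₀).symm ∘ f := by
    filter_upwards [(isOpen_extChartAt_target x₀).mem_nhds hu] with z hz
    simp only [Function.comp_apply]
    rw [chartExtend_of_mem f ((extChartAt (𝓡 d) x₀).map_target hz),
      (extChartAt (𝓡 d) x₀).right_inv hz]
  exact congrArg (fun A => A v) (hasMFDerivAt_unique h1 (h2.congr_of_eventuallyEq h3))

omit [IsManifold (𝓡 d) ∞ M] in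
theorem TangentDistribution.mem_congr (ξ : TangentDistribution d M) {y y' : M} (h : y = y')
    {v v' : EuclideanSpace ℝ (Fin d)} (h' : v = v')
    (hv : (show TangentSpace (𝓡 d) y from v) ∈ ξ y) :
    (show TangentSpace (𝓡 d) y' from v') ∈ ξ y' := by
  subst h h'
  exact hv

omit [IsManifold (𝓡 d) ∞ M] in
/-- A diffeomorphism that maps a distribution into itself, as does its inverse, preserves it. -/
theorem IsContactomorphism.of_mem {ξ : TangentDistribution d M} {φ : Equiv.Perm M}
    (h : ContMDiff (𝓡 d) (𝓡 d) ∞ φ) (h' : ContMDiff (𝓡 d) (𝓡 d) ∞ φ.symm)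
    (hξ : ∀ y, ∀ v ∈ ξ y, mfderiv (𝓡 d) (𝓡 d) φ y v ∈ ξ (φ y))
    (hξ' : ∀ y, ∀ v ∈ ξ y, mfderiv (𝓡 d) (𝓡 d) φ.symm y v ∈ ξ (φ.symm y)) :
    IsContactomorphism ξ φ := by
  refine ⟨h, h', fun y => le_antisymm ?_ fun w hw => ?_⟩
  · rintro _ ⟨v, hv, rfl⟩
    exact hξ y v hv
  · refine ⟨mfderiv (𝓡 d) (𝓡 d) φ.symm (φ y) w, ξ.mem_congr (φ.symm_apply_apply y) rfl (hξ' _ w hw), ?_⟩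
    have h1 : (mfderiv (𝓡 d) (𝓡 d) φ y).comp (mfderiv (𝓡 d) (𝓡 d) φ.symm (φ y)) =
        ContinuousLinearMap.id ℝ (TangentSpace (𝓡 d) (φ y)) := by
      have h2 : HasMFDerivAt (𝓡 d) (𝓡 d) φ (φ.symm (φ y)) (mfderiv (𝓡 d) (𝓡 d) φ y) := by
        have h3 : ∀ z, z = y → HasMFDerivAt (𝓡 d) (𝓡 d) φ z (mfderiv (𝓡 d) (𝓡 d) φ y) := by
          rintro _ rfl
          exact (h.mdifferentiableAt (by simp)).hasMFDerivAt
        exact h3 _ (φ.symm_apply_apply y)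
      have h4 := h2.comp (φ y) (h'.mdifferentiableAt (by simp)).hasMFDerivAt
      have h5 : ⇑φ ∘ ⇑φ.symm = id := by ext z; simp
      rw [h5] at h4
      exact hasMFDerivAt_unique h4 (hasMFDerivAt_id _)
    exact congrArg (fun A => A w) h1

end Transport

section ContactTransport

open scoped Topology

variable {n : ℕ} {M : Type*} [TopologicalSpace M] [T2Space M]
  [ChartedSpace (EuclideanSpace ℝ (Fin (2 * n + 1))) M] [IsManifold (𝓡 (2 * n + 1)) ∞ M]
  {ξ : TangentDistribution (2 * n + 1) M} {α : CovectorField (2 * n + 1) M} {x₀ : M}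
  {X : EuclideanSpace ℝ (Fin (2 * n + 1)) → EuclideanSpace ℝ (Fin (2 * n + 1))}
  {Φ : ℝ → EuclideanSpace ℝ (Fin (2 * n + 1)) → EuclideanSpace ℝ (Fin (2 * n + 1))}

theorem IsContactField.flow_eq_self {a : EuclideanSpace ℝ (Fin (2 * n + 1)) →
      EuclideanSpace ℝ (Fin (2 * n + 1)) →L[ℝ] ℝ} {U : Set (EuclideanSpace ℝ (Fin (2 * n + 1)))}
    (hX : IsContactField a U X) (hΦ : IsFlow X Φ) (t : ℝ) (u) (hu : u ∉ tsupport X) :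
    Φ t u = u := by
  obtain ⟨K, hK⟩ := hX.exists_lipschitzWith
  exact hΦ.apply_eq_self hK (image_eq_zero_of_notMem_tsupport hu) t

/-- The flow of a contact vector field supported in a chart preserves the contact structure. -/
theorem chartExtend_preserves (hα : IsContactForm α)
    (hξ : ∀ (x : M) (v : TangentSpace (𝓡 (2 * n + 1)) x), v ∈ ξ x ↔ α x v = 0)
    (hX : IsContactField (α.chartForm x₀) (extChartAt (𝓡 (2 * n + 1)) x₀).target X) (hΦ : IsFlow X Φ)
    (hsm : ContDiff ℝ ∞ (fun q : ℝ × EuclideanSpace ℝ (Fin (2 * n + 1)) => Φ q.1 q.2)) (t : ℝ)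
    (y : M) (v : TangentSpace (𝓡 (2 * n + 1)) y) (hv : v ∈ ξ y) :
    mfderiv (𝓡 (2 * n + 1)) (𝓡 (2 * n + 1)) (chartExtend x₀ (Φ t)) y v ∈
      ξ (chartExtend x₀ (Φ t) y) := by
  have hmaps : ∀ t, MapsTo (Φ t) (extChartAt (𝓡 (2 * n + 1)) x₀).target
      (extChartAt (𝓡 (2 * n + 1)) x₀).target := fun t u hu => hX.flow_mem hΦ hu t
  by_cases hy : y ∈ (extChartAt (𝓡 (2 * n + 1)) x₀).source
  · obtain ⟨u, hu, rfl⟩ : ∃ u ∈ (extChartAt (𝓡 (2 * n + 1)) x₀).target,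
        (extChartAt (𝓡 (2 * n + 1)) x₀).symm u = y :=
      ⟨_, (extChartAt (𝓡 (2 * n + 1)) x₀).map_source hy,
        (extChartAt (𝓡 (2 * n + 1)) x₀).left_inv hy⟩
    obtain ⟨v', rfl⟩ := (bijective_mfderiv_extChartAt_symm hu).surjective v
    have hd : MDifferentiableAt (𝓡 (2 * n + 1)) (𝓡 (2 * n + 1)) (chartExtend x₀ (Φ t))
        ((extChartAt (𝓡 (2 * n + 1)) x₀).symm u) :=
      ((contMDiff_chartExtend hsm hmaps hX.hasCompactSupport hX.tsupport_subset
        (hX.flow_eq_self hΦ)).comp (contMDiff_const.prodMk contMDiff_id)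
        (f := fun y : M => (t, y))).mdifferentiableAt (by simp)
    have hΦd : Differentiable ℝ (Φ t) :=
      (hsm.comp (contDiff_const.prodMk contDiff_id) (f := fun u => (t, u))).differentiable (by simp)
    have h1 : α.chartForm x₀ (Φ t u) (fderiv ℝ (Φ t) u v') = 0 :=
      hX.flow_preserves (isLocalContactForm_chartForm hα x₀) hΦ hsm hu ((hξ _ _).1 hv) t
    have h2 : (extChartAt (𝓡 (2 * n + 1)) x₀).symm (Φ t u) =
        chartExtend x₀ (Φ t) ((extChartAt (𝓡 (2 * n + 1)) x₀).symm u) := by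
      rw [chartExtend_of_mem _ hy, (extChartAt (𝓡 (2 * n + 1)) x₀).right_inv hu]
    exact ξ.mem_congr h2 (mfderiv_chartExtend hΦd (hmaps t) hu hd v').symm ((hξ _ _).2 h1)
  · have hy' : y ∉ (extChartAt (𝓡 (2 * n + 1)) x₀).symm '' tsupport X := by
      rintro ⟨u, hu, rfl⟩
      exact hy ((extChartAt (𝓡 (2 * n + 1)) x₀).map_target (hX.tsupport_subset hu))
    have h1 : chartExtend x₀ (Φ t) =ᶠ[𝓝 y] id := by
      filter_upwards [(isCompact_extChartAt_symm_image hX.hasCompactSupport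
        hX.tsupport_subset).isClosed.isOpen_compl.mem_nhds hy'] with z hz
      exact chartExtend_eq_self (hX.flow_eq_self hΦ t) hz
    have h2 := ((hasMFDerivAt_id (I := 𝓡 (2 * n + 1)) y).congr_of_eventuallyEq h1).mfderiv
    rw [h2]
    exact ξ.mem_congr h1.eq_of_nhds.symm rfl hv

/-- The flow of a contact vector field supported in a chart is a compactly supported contact
isotopy. -/
theorem exists_mem_identityComponentCont (hα : IsContactForm α)
    (hξ : ∀ (x : M) (v : TangentSpace (𝓡 (2 * n + 1)) x), v ∈ ξ x ↔ α x v = 0)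
    (hX : IsContactField (α.chartForm x₀) (extChartAt (𝓡 (2 * n + 1)) x₀).target X) (hΦ : IsFlow X Φ)
    (hsm : ContDiff ℝ ∞ (fun q : ℝ × EuclideanSpace ℝ (Fin (2 * n + 1)) => Φ q.1 q.2)) :
    ∃ g ∈ identityComponentCont ξ, ⇑g = chartExtend x₀ (Φ 1) := by
  have hmaps : ∀ t, MapsTo (Φ t) (extChartAt (𝓡 (2 * n + 1)) x₀).target
      (extChartAt (𝓡 (2 * n + 1)) x₀).target := fun t u hu => hX.flow_mem hΦ hu t
  have hjoint := contMDiff_chartExtend hsm hmaps hX.hasCompactSupport hX.tsupport_subset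
    (hX.flow_eq_self hΦ)
  have hneg : ContMDiff (𝓘(ℝ, ℝ).prod (𝓡 (2 * n + 1))) (𝓡 (2 * n + 1)) ∞
      (fun p : ℝ × M => chartExtend x₀ (Φ (-p.1)) p.2) :=
    contMDiff_chartExtend (Φ := fun t => Φ (-t))
      (hsm.comp (contDiff_fst.neg.prodMk contDiff_snd)) (fun t => hmaps (-t))
      hX.hasCompactSupport hX.tsupport_subset (fun t => hX.flow_eq_self hΦ (-t))
  have hat : ∀ t, ContMDiff (𝓡 (2 * n + 1)) (𝓡 (2 * n + 1)) ∞
      (chartExtend x₀ (Φ t) : M → M) := fun t =>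
    hjoint.comp (contMDiff_const.prodMk contMDiff_id) (f := fun y : M => (t, y))
  refine ⟨chartFlow x₀ hΦ hmaps 1, ⟨chartFlow x₀ hΦ hmaps, ?_, rfl⟩, rfl⟩
  refine ⟨hjoint.contMDiffOn, hneg.contMDiffOn, fun t _ => ?_,
    ⟨_, isCompact_extChartAt_symm_image hX.hasCompactSupport hX.tsupport_subset,
      fun t _ x hx => chartExtend_eq_self (hX.flow_eq_self hΦ t) hx⟩, ?_⟩
  · exact IsContactomorphism.of_mem (hat t) (hat (-t))
      (chartExtend_preserves hα hξ hX hΦ hsm t) (chartExtend_preserves hα hξ hX hΦ hsm (-t))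
  · ext y
    exact chartExtend_eq_self (S := ∅) (fun u _ => hΦ.zero u) (by simp)

end ContactTransport

end

theorem mainTheorem1 (n : ℕ) (M : Type*) [TopologicalSpace M] [T2Space M]
    [SecondCountableTopology M] [ConnectedSpace M]
    [ChartedSpace (EuclideanSpace ℝ (Fin (2 * n + 1))) M] [IsManifold (𝓡 (2 * n + 1)) ∞ M]
    (ξ : TangentDistribution (2 * n + 1) M) (hξ : IsContactStructure ξ) :
    ¬ ∃ ν : GroupNorm (identityComponentCont ξ), ν.IsConjInvariant ∧ ν.IsFine := by
  obtain ⟨α, hα, hξα⟩ := hξ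
  have hcont : ∀ g ∈ identityComponentCont ξ, Continuous g := by
    rintro _ ⟨γ, hγ, rfl⟩
    exact (hγ.contacto 1 ⟨zero_le_one, le_rfl⟩).contMDiff.continuous
  have hloc : ∀ x : M, ∃ N : Set M, IsOpen N ∧ x ∈ N ∧ ∀ V : Set M, IsOpen V →
      (V ∩ N).Nonempty → ∃ g ∈ identityComponentCont ξ, ∀ y ∈ N, g y ∈ V := by
    intro x
    obtain ⟨ρ, hρ, hρU, hsq⟩ := (isLocalContactForm_chartForm hα x).exists_squeezing
      (mem_extChartAt_target x)
    refine ⟨_, isOpen_extChartAt_preimage' (I := 𝓡 (2 * n + 1)) x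
      (Metric.isOpen_ball (x := extChartAt (𝓡 (2 * n + 1)) x x) (ε := ρ)),
      ⟨mem_extChartAt_source x, Metric.mem_ball_self hρ⟩, ?_⟩
    rintro V hV ⟨y, hyV, hys, hyρ⟩
    have h1 : (extChartAt (𝓡 (2 * n + 1)) x).symm ⁻¹' V ∈
        nhds (extChartAt (𝓡 (2 * n + 1)) x y) := by
      refine (continuousAt_extChartAt_symm' hys).preimage_mem_nhds (hV.mem_nhds ?_)
      rwa [(extChartAt (𝓡 (2 * n + 1)) x).left_inv hys]
    obtain ⟨ε, hε, hεV⟩ := Metric.mem_nhds_iff.1 h1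
    obtain ⟨X, Φ, hX, hΦ, hsm, hΦε⟩ := hsq _ hyρ ε hε
    obtain ⟨g, hg, hgΦ⟩ := exists_mem_identityComponentCont hα hξα hX hΦ hsm
    refine ⟨g, hg, fun z hz => ?_⟩
    rw [hgΦ, chartExtend_of_mem _ hz.1]
    exact hεV (hΦε _ hz.2)
  have hsupp : ∀ V : Set M, IsOpen V → V.Nonempty →
      ∃ g ∈ identityComponentCont ξ, g ≠ 1 ∧ ∀ x ∉ V, g x = x := by
    rintro V hV ⟨x, hxV⟩
    have hopen : IsOpen ((extChartAt (𝓡 (2 * n + 1)) x).target ∩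
        (extChartAt (𝓡 (2 * n + 1)) x).symm ⁻¹' V) :=
      (continuousOn_extChartAt_symm x).isOpen_inter_preimage (isOpen_extChartAt_target x) hV
    obtain ⟨X, Φ, hX, hXV, hΦ, hsm, u, hu⟩ := (isLocalContactForm_chartForm hα x).exists_ne_id hopen
      inter_subset_left ⟨_, mem_extChartAt_target x, by
        rwa [mem_preimage, extChartAt_to_inv]⟩
    obtain ⟨g, hg, hgΦ⟩ := exists_mem_identityComponentCont hα hξα hX hΦ hsm
    refine ⟨g, hg, ?_, fun z hz => ?_⟩
    · rintro rfl
      have huX : u ∈ tsupport X := by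
        by_contra h
        exact hu (hX.flow_eq_self hΦ 1 u h)
      have huU := hX.tsupport_subset huX
      have h1 := congrFun hgΦ ((extChartAt (𝓡 (2 * n + 1)) x).symm u)
      rw [chartExtend_of_mem _ ((extChartAt (𝓡 (2 * n + 1)) x).map_target huU),
        (extChartAt (𝓡 (2 * n + 1)) x).right_inv huU] at h1
      exact hu ((extChartAt (𝓡 (2 * n + 1)) x).symm.injOn (hX.flow_mem hΦ huU 1) huU h1.symm)
    · rw [hgΦ]
      refine chartExtend_eq_self (hX.flow_eq_self hΦ 1) ?_
      rintro ⟨w, hw, rfl⟩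
      exact hz (hXV hw).2
  obtain ⟨B, hB, hBne, hBsq⟩ := exists_forall_squeezed hloc
  exact not_exists_isFine hcont hB hBne hBsq hsupp
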